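/- Let $A$ be a separable, simple, unital, exact and stably finite C$^*$-algebra. Let $M_\infty(A)=\bigcup_n M_n(A)$. For $a,b\in M_\infty(A)_+$ write $a\precsim b$ if $\|v_kbv_k^*-a\|\to 0$ for some sequence $(v_k)$ in $M_\infty(A)$, and $a\sim b$ if $a\precsim b\precsim a$. Let $W(A)=M_\infty(A)_+/{\sim}$ be the Cuntz semigroup, with classes $\langle a\rangle$, sum $\langle a\rangle+\langle b\rangle=\langle a\oplus b\rangle$ and order $\langle a\rangle\le\langle b\rangle\iff a\precsim b$. Let $\mathrm{DF}(A)$ be the set of dimension functions on $A$, that is, of additive order-preserving maps $s\colon W(A)\to[0,\infty)$ with $s(\langle 1_A\rangle)=1$, with the topology of pointwise convergence. Let $\mathrm{T}(A)$ be the space of tracial states of $A$ with the weak-$*$ topology; extend each $\tau\in \mathrm{T}(A)$ to $M_n(A)$ by $\tau((a_{ij}))=\sum_i\tau(a_{ii})$, and put $d_\tau(a)=\lim_{k\to\infty}\tau(a^{1/k})$ for $a\in M_\infty(A)_+$. Let $V(A)$ be the set of Murray--von Neumann classes $[p]$ of projections $p\in M_\infty(A)$, ordered by Murray--von Neumann subequivalence,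 and for $x=[p]$ put $\hat x(\tau)=\tau(p)$. Let $\mathrm{LAff}_b(\mathrm{T}(A))^{++}$ be the set of bounded, strictly positive, lower semicontinuous affine functions $\mathrm{T}(A)\to\mathbb{R}$, and let $$\widetilde W(A)=V(A)\sqcup \mathrm{LAff}_b(\mathrm{T}(A))^{++},$$ with the order that restricts to the given order on $V(A)$ and to the pointwise order on $\mathrm{LAff}_b(\mathrm{T}(A))^{++}$ and satisfies, for $x\in V(A)$ and $f\in\mathrm{LAff}_b(\mathrm{T}(A))^{++}$: $x\le f$ iff $\hat x(\tau)<f(\tau)$ for all $\tau\in\mathrm{T}(A)$, and $f\le x$ iff $f(\tau)\le\hat x(\tau)$ for all $\tau\in\mathrm{T}(A)$. Let $\phi\colon W(A)\to\widetilde W(A)$ be the canonical map, given by $\phi(\langle p\rangle)=[p]$ for every projection $p\in M_\infty(A)$, and $\phi(\langle a\rangle)=(\tau\mapsto d_\tau(a))$ for every $a\in M_\infty(A)_+$ that is not Cuntz equivalent to a projection in $M_\infty(A)$. If $\phi$ is an order isomorphism, then $\mathrm{DF}(A)$ is a Choquet simplex: it is a nonempty compact convex subset of the locally convex space $\mathbb{R}^{W(A)}$,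 and the cone $\{(ts,t): t\ge 0,\ s\in\mathrm{DF}(A)\}\subset\mathbb{R}^{W(A)}\times\mathbb{R}$ is a lattice in its own order. -/

import Mathlib

open scoped CStarAlgebra ComplexOrder NNReal Topology

noncomputable section

namespace CuntzDim

universe u

/-- `MatC n m A`: the `n × m` matrices over the C⋆-algebra `A`, with the C⋆-norm (operator norm)
and, when `n = m`, the C⋆-algebra order. -/
abbrev MatC (n m : ℕ) (A : Type u) : Type u := CStarMatrix (Fin n) (Fin m) A

section Matrices

variable {A : Type u} [CStarAlgebra A]

theorem mat_mul_assoc {k l m n : ℕ} (a : MatC k l A) (b : MatC l m A) (c : MatC m n A) :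
    a * b * c = a * (b * c) :=
  Matrix.mul_assoc (show Matrix (Fin k) (Fin l) A from a) (show Matrix (Fin l) (Fin m) A from b)
    (show Matrix (Fin m) (Fin n) A from c)

theorem mat_conjTranspose_mul {l m n : ℕ} (a : MatC l m A) (b : MatC m n A) :
    (a * b).conjTranspose = b.conjTranspose * a.conjTranspose :=
  Matrix.conjTranspose_mul (show Matrix (Fin l) (Fin m) A from a)
    (show Matrix (Fin m) (Fin n) A from b)

theorem mat_conjTranspose_conjTranspose {m n : ℕ} (a : MatC m n A) :
    a.conjTranspose.conjTranspose = a :=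
  Matrix.conjTranspose_conjTranspose (show Matrix (Fin m) (Fin n) A from a)

theorem mat_one_mul {m n : ℕ} (a : MatC m n A) : (1 : MatC m m A) * a = a :=
  Matrix.one_mul (show Matrix (Fin m) (Fin n) A from a)

theorem mat_mul_one {m n : ℕ} (a : MatC m n A) : a * (1 : MatC n n A) = a :=
  Matrix.mul_one (show Matrix (Fin m) (Fin n) A from a)

theorem mat_conjTranspose_one {n : ℕ} : (1 : MatC n n A).conjTranspose = 1 :=
  Matrix.conjTranspose_one (n := Fin n) (α := A)

/-- The block-diagonal sum `a ⊕ b`. -/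
def dsum {k l m n : ℕ} (a : MatC k l A) (b : MatC m n A) : MatC (k + m) (l + n) A :=
  CStarMatrix.ofMatrix
    (Matrix.reindex finSumFinEquiv finSumFinEquiv
      (Matrix.fromBlocks (CStarMatrix.ofMatrix.symm a) 0 0 (CStarMatrix.ofMatrix.symm b)))

theorem dsum_mul {k l m n p q : ℕ} (a : MatC k l A) (b : MatC m n A) (a' : MatC l p A)
    (b' : MatC n q A) : dsum a b * dsum a' b' = dsum (a * a') (b * b') := by
  have h : (Matrix.reindex finSumFinEquiv finSumFinEquiv
        (Matrix.fromBlocks (CStarMatrix.ofMatrix.symm a) 0 0 (CStarMatrix.ofMatrix.symm b))) *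
      (Matrix.reindex finSumFinEquiv finSumFinEquiv
        (Matrix.fromBlocks (CStarMatrix.ofMatrix.symm a') 0 0 (CStarMatrix.ofMatrix.symm b'))) =
      Matrix.reindex finSumFinEquiv finSumFinEquiv
        (Matrix.fromBlocks (CStarMatrix.ofMatrix.symm a * CStarMatrix.ofMatrix.symm a') 0 0
          (CStarMatrix.ofMatrix.symm b * CStarMatrix.ofMatrix.symm b')) := by
    simp only [Matrix.reindex_apply, Matrix.submatrix_mul_equiv, Matrix.fromBlocks_multiply,
      Matrix.mul_zero, Matrix.zero_mul, add_zero, zero_add]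
  exact h

theorem dsum_conjTranspose {k l m n : ℕ} (a : MatC k l A) (b : MatC m n A) :
    (dsum a b).conjTranspose = dsum a.conjTranspose b.conjTranspose := by
  have h : (Matrix.reindex finSumFinEquiv finSumFinEquiv
        (Matrix.fromBlocks (CStarMatrix.ofMatrix.symm a) 0 0
          (CStarMatrix.ofMatrix.symm b))).conjTranspose =
      Matrix.reindex finSumFinEquiv finSumFinEquiv
        (Matrix.fromBlocks (CStarMatrix.ofMatrix.symm a).conjTranspose 0 0
          (CStarMatrix.ofMatrix.symm b).conjTranspose) := by
    simp only [Matrix.reindex_apply, Matrix.conjTranspose_submatrix,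
      Matrix.fromBlocks_conjTranspose, Matrix.conjTranspose_zero]
  exact h

theorem continuous_mat_mul {l m n : ℕ} :
    Continuous fun x : MatC l m A × MatC m n A => x.1 * x.2 :=
  Continuous.matrix_mul (X := MatC l m A × MatC m n A) (R := A)
    (A := fun x => CStarMatrix.ofMatrix.symm x.1) (B := fun x => CStarMatrix.ofMatrix.symm x.2)
    continuous_fst continuous_snd

theorem continuous_dsum {k l m n : ℕ} :
    Continuous fun x : MatC k l A × MatC m n A => dsum x.1 x.2 := by
  have h : Continuous fun x : MatC k l A × MatC m n A =>
      Matrix.reindex finSumFinEquiv finSumFinEquiv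
        (Matrix.fromBlocks (CStarMatrix.ofMatrix.symm x.1) 0 0 (CStarMatrix.ofMatrix.symm x.2)) :=
    Continuous.matrix_reindex
      (Continuous.matrix_fromBlocks continuous_fst continuous_const continuous_const
        continuous_snd) _ _
  exact h

variable [PartialOrder A] [StarOrderedRing A]

theorem exists_star_mul_self_of_nonneg {B : Type u} [CStarAlgebra B] [PartialOrder B]
    [h : StarOrderedRing B] {a : B} (ha : 0 ≤ a) : ∃ x, a = star x * x :=
  CStarAlgebra.nonneg_iff_eq_star_mul_self.mp ha

theorem dsum_nonneg {m n : ℕ} {a : MatC m m A} {b : MatC n n A} (ha : 0 ≤ a) (hb : 0 ≤ b) :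
    0 ≤ dsum a b := by
  obtain ⟨x, rfl⟩ := exists_star_mul_self_of_nonneg (h := CStarMatrix.instStarOrderedRing) ha
  obtain ⟨y, rfl⟩ := exists_star_mul_self_of_nonneg (h := CStarMatrix.instStarOrderedRing) hb
  have h : dsum (star x * x) (star y * y) = star (dsum x y) * dsum x y := by
    rw [CStarMatrix.star_eq_conjTranspose, CStarMatrix.star_eq_conjTranspose,
      CStarMatrix.star_eq_conjTranspose, dsum_conjTranspose]
    exact (dsum_mul _ _ _ _).symm
  rw [h]
  exact star_mul_self_nonneg _

end Matrices

/-! ### The Cuntz semigroup -/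

section Cuntz

variable {A : Type u} [CStarAlgebra A] [PartialOrder A] [StarOrderedRing A]

/-- Cuntz subequivalence `a ≾ b` of square matrices: `v_k b v_k⋆ → a` in norm for some sequence
`v_k`. Regarding `a` and `b` as elements of `M_∞(A)`, the `v_k` may be cut down to the relevant
`m × n` corner, so it makes no difference whether they are taken there or in `M_∞(A)`. -/
def CuntzLE {m n : ℕ} (a : MatC m m A) (b : MatC n n A) : Prop :=
  ∃ v : ℕ → MatC m n A,
    Filter.Tendsto (fun k => ‖v k * b * (v k).conjTranspose - a‖) Filter.atTop (𝓝 0)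

theorem cuntzLE_iff_mem_closure {m n : ℕ} {a : MatC m m A} {b : MatC n n A} :
    CuntzLE a b ↔ a ∈ closure (Set.range fun v : MatC m n A => v * b * v.conjTranspose) := by
  rw [mem_closure_iff_seq_limit]
  constructor
  · rintro ⟨v, hv⟩
    exact ⟨fun k => v k * b * (v k).conjTranspose, fun k => ⟨v k, rfl⟩,
      tendsto_iff_norm_sub_tendsto_zero.mpr hv⟩
  · rintro ⟨x, hx, hlim⟩
    choose v hv using hx
    refine ⟨v, ?_⟩
    have := tendsto_iff_norm_sub_tendsto_zero.mp hlim
    simpa only [← hv] using this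

theorem CuntzLE.refl {m : ℕ} (a : MatC m m A) : CuntzLE a a := by
  refine ⟨fun _ => 1, ?_⟩
  simp only [mat_conjTranspose_one, mat_one_mul, mat_mul_one, sub_self, norm_zero]
  exact tendsto_const_nhds

theorem CuntzLE.trans {l m n : ℕ} {a : MatC l l A} {b : MatC m m A} {c : MatC n n A}
    (hab : CuntzLE a b) (hbc : CuntzLE b c) : CuntzLE a c := by
  rw [cuntzLE_iff_mem_closure] at *
  refine closure_minimal ?_ isClosed_closure hab
  rintro _ ⟨v, rfl⟩
  have hcont : Continuous fun x : MatC m m A => v * x * v.conjTranspose :=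
    continuous_mat_mul.comp
      ((continuous_mat_mul.comp (continuous_const.prodMk continuous_id)).prodMk continuous_const)
  refine map_mem_closure (f := fun x : MatC m m A => v * x * v.conjTranspose) hcont hbc ?_
  rintro _ ⟨w, rfl⟩
  refine ⟨v * w, ?_⟩
  simp only [mat_conjTranspose_mul, mat_mul_assoc]

theorem CuntzLE.dsum {k l m n : ℕ} {a : MatC k k A} {b : MatC l l A} {a' : MatC m m A}
    {b' : MatC n n A} (ha : CuntzLE a a') (hb : CuntzLE b b') :
    CuntzLE (dsum a b) (dsum a' b') := by
  rw [cuntzLE_iff_mem_closure] at *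
  refine map_mem_closure₂ (f := fun x y => CuntzDim.dsum x y) continuous_dsum ha hb ?_
  rintro _ ⟨v, rfl⟩ _ ⟨w, rfl⟩
  refine ⟨CuntzDim.dsum v w, ?_⟩
  simp only [dsum_conjTranspose, dsum_mul]

variable (A) in
/-- Representatives of the elements of `M_∞(A)_+`: positive square matrices of any size. -/
structure PosMat where
  /-- the size of the matrix -/
  size : ℕ
  /-- the matrix -/
  mat : MatC size size A
  nonneg : 0 ≤ mat

/-- Positive matrices, preordered by Cuntz subequivalence. -/
instance : Preorder (PosMat A) where
  le a b := CuntzLE a.mat b.mat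
  le_refl a := CuntzLE.refl a.mat
  le_trans _ _ _ h₁ h₂ := h₁.trans h₂

/-- The sum `a ⊕ b` of positive matrices. -/
def PosMat.dsum (a b : PosMat A) : PosMat A where
  size := a.size + b.size
  mat := CuntzDim.dsum a.mat b.mat
  nonneg := dsum_nonneg a.nonneg b.nonneg

variable (A) in
/-- The Cuntz semigroup `W(A)`: the quotient of `M_∞(A)_+` by Cuntz equivalence
(`a ∼ b` iff `a ≾ b` and `b ≾ a`), with the partial order induced by `≾`. -/
def W : Type u := Antisymmetrization (PosMat A) (· ≤ ·)

instance : PartialOrder (W A) :=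
  inferInstanceAs (PartialOrder (Antisymmetrization (PosMat A) (· ≤ ·)))

/-- The class `⟨a⟩` of a positive matrix. -/
def W.mk (a : PosMat A) : W A := toAntisymmetrization (· ≤ ·) a

/-- Addition on `W(A)`: `⟨a⟩ + ⟨b⟩ = ⟨a ⊕ b⟩`. -/
instance : Add (W A) where
  add := Quotient.map₂ PosMat.dsum fun _ _ h₁ _ _ h₂ =>
    ⟨CuntzLE.dsum h₁.1 h₂.1, CuntzLE.dsum h₁.2 h₂.2⟩

theorem W.mk_le_mk {a b : PosMat A} : W.mk a ≤ W.mk b ↔ CuntzLE a.mat b.mat := Iff.rfl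

theorem W.mk_add_mk (a b : PosMat A) : W.mk a + W.mk b = W.mk (a.dsum b) := rfl

variable (A) in
/-- The class `⟨1_A⟩` of the unit, as a `1 × 1` matrix. -/
def W.unit : W A := W.mk ⟨1, 1, zero_le_one⟩

variable (A) in
/-- The dimension functions on `A`: additive, order-preserving maps `s : W(A) → ℝ⁺` with
`s ⟨1_A⟩ = 1`. They form a subset of the locally convex space `W(A) → ℝ`, with the topology of
pointwise convergence. -/
def DF : Set (W A → ℝ) :=
  {s | (∀ x, 0 ≤ s x) ∧ Monotone s ∧ (∀ x y, s (x + y) = s x + s y) ∧ s (W.unit A) = 1}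

end Cuntz

/-! ### The Murray–von Neumann semigroup -/

section Projections

variable {A : Type u} [CStarAlgebra A]

variable (A) in
/-- Projections in `M_∞(A)`: self-adjoint idempotent square matrices of any size. -/
structure ProjMat where
  /-- the size of the matrix -/
  size : ℕ
  /-- the matrix -/
  mat : MatC size size A
  isProj : IsStarProjection mat

/-- Murray–von Neumann equivalence: `p = v⋆ v` and `q = v v⋆`. -/
def MvNEquiv (p q : ProjMat A) : Prop :=
  ∃ v : MatC q.size p.size A, v.conjTranspose * v = p.mat ∧ v * v.conjTranspose = q.mat

/-- Murray–von Neumann subequivalence: `p = v⋆ v` with `v v⋆` a subprojection of `q`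
(that is, `q v = v`). -/
def MvNLE (p q : ProjMat A) : Prop :=
  ∃ v : MatC q.size p.size A, v.conjTranspose * v = p.mat ∧ q.mat * v = v

theorem ProjMat.mul_self (p : ProjMat A) : p.mat * p.mat = p.mat :=
  p.isProj.isIdempotentElem.eq

theorem ProjMat.conjTranspose_eq (p : ProjMat A) : p.mat.conjTranspose = p.mat :=
  p.isProj.isSelfAdjoint.star_eq

theorem MvNEquiv.refl (p : ProjMat A) : MvNEquiv p p :=
  ⟨p.mat, by rw [p.conjTranspose_eq]; exact p.mul_self,
    by rw [p.conjTranspose_eq]; exact p.mul_self⟩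

theorem MvNEquiv.symm {p q : ProjMat A} (h : MvNEquiv p q) : MvNEquiv q p := by
  obtain ⟨v, h₁, h₂⟩ := h
  exact ⟨v.conjTranspose, by rw [mat_conjTranspose_conjTranspose]; exact h₂,
    by rw [mat_conjTranspose_conjTranspose]; exact h₁⟩

theorem conj_eq {l m n : ℕ} {v : MatC m l A} {w : MatC n m A} {p : MatC l l A}
    (hp : p * p = p) (hv : v.conjTranspose * v = p) (h : w.conjTranspose * w = v * v.conjTranspose) :
    (w * v).conjTranspose * (w * v) = p := by
  calc (w * v).conjTranspose * (w * v)
      = v.conjTranspose * ((w.conjTranspose * w) * v) := by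
        simp only [mat_conjTranspose_mul, mat_mul_assoc]
    _ = (v.conjTranspose * v) * (v.conjTranspose * v) := by
        simp only [h, mat_mul_assoc]
    _ = p := by rw [hv]; exact hp

theorem MvNEquiv.trans {p q r : ProjMat A} (h₁ : MvNEquiv p q) (h₂ : MvNEquiv q r) :
    MvNEquiv p r := by
  obtain ⟨v, hv₁, hv₂⟩ := h₁
  obtain ⟨w, hw₁, hw₂⟩ := h₂
  refine ⟨w * v, conj_eq p.mul_self hv₁ (hw₁.trans hv₂.symm), ?_⟩
  have := conj_eq (v := w.conjTranspose) (w := v.conjTranspose) r.mul_self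
    (by rw [mat_conjTranspose_conjTranspose]; exact hw₂)
    (by simp only [mat_conjTranspose_conjTranspose]; exact hv₂.trans hw₁.symm)
  rw [← mat_conjTranspose_mul, mat_conjTranspose_conjTranspose] at this
  exact this

theorem MvNLE.congr {p p' q q' : ProjMat A} (hp : MvNEquiv p p') (hq : MvNEquiv q q')
    (h : MvNLE p q) : MvNLE p' q' := by
  obtain ⟨u, hu₁, hu₂⟩ := hp.symm
  obtain ⟨w, hw₁, hw₂⟩ := hq
  obtain ⟨v, hv₁, hv₂⟩ := h
  refine ⟨w * (v * u), ?_, ?_⟩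
  · have h₁ : (v * u).conjTranspose * (v * u) = p'.mat :=
      conj_eq p'.mul_self hu₁ (hv₁.trans hu₂.symm)
    calc (w * (v * u)).conjTranspose * (w * (v * u))
        = u.conjTranspose * (v.conjTranspose * ((w.conjTranspose * w) * v) * u) := by
          simp only [mat_conjTranspose_mul, mat_mul_assoc]
      _ = (v * u).conjTranspose * (v * u) := by
          rw [hw₁, hv₂]; simp only [mat_conjTranspose_mul, mat_mul_assoc]
      _ = p'.mat := h₁
  · calc q'.mat * (w * (v * u)) = w * ((w.conjTranspose * w) * v) * u := by
          rw [← hw₂]; simp only [mat_mul_assoc]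
      _ = w * (v * u) := by rw [hw₁, hv₂, mat_mul_assoc]

instance mvnSetoid : Setoid (ProjMat A) where
  r := MvNEquiv
  iseqv := ⟨MvNEquiv.refl, MvNEquiv.symm, MvNEquiv.trans⟩

variable (A) in
/-- `V(A)`: Murray–von Neumann equivalence classes of projections in `M_∞(A)`. -/
def V : Type u := Quotient (mvnSetoid (A := A))

/-- The class `[p]` of a projection. -/
def V.mk (p : ProjMat A) : V A := Quotient.mk _ p

/-- The usual order on `V(A)`: `[p] ≤ [q]` iff `p` is Murray–von Neumann subequivalent to `q`. -/
instance : LE (V A) where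
  le := Quotient.lift₂ MvNLE fun _ _ _ _ h₁ h₂ =>
    propext ⟨MvNLE.congr h₁ h₂, MvNLE.congr (MvNEquiv.symm h₁) (MvNEquiv.symm h₂)⟩

theorem V.mk_le_mk {p q : ProjMat A} : V.mk p ≤ V.mk q ↔ MvNLE p q := Iff.rfl

variable [PartialOrder A] [StarOrderedRing A]

/-- A projection, regarded as a positive matrix. -/
def ProjMat.toPosMat (p : ProjMat A) : PosMat A where
  size := p.size
  mat := p.mat
  nonneg := p.isProj.nonneg

end Projections

/-! ### Tracial states and the semigroup `W̃(A)` -/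

section Traces

variable (A : Type u) [CStarAlgebra A] [PartialOrder A] [StarOrderedRing A]

/-- The tracial states of `A`, with the weak-⋆ topology. -/
def tracialStates : Set (WeakDual ℂ A) :=
  {τ | (∀ a : A, 0 ≤ a → 0 ≤ τ a) ∧ τ 1 = 1 ∧ ∀ a b : A, τ (a * b) = τ (b * a)}

/-- The tracial state space `T(A)`. -/
abbrev T : Type u := tracialStates A

variable {A}

/-- The (unnormalised) extension of a tracial state to square matrices,
`τ(a) = ∑ i, τ(a i i)`. (It is used only on positive matrices, where the values are real.) -/
def mtr (τ : T A) {n : ℕ} (a : MatC n n A) : ℝ := ∑ i, (τ.1 (a i i)).re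

theorem mtr_comm (τ : T A) {m n : ℕ} (a : MatC m n A) (b : MatC n m A) :
    mtr τ (a * b) = mtr τ (b * a) := by
  simp only [mtr, CStarMatrix.mul_apply, map_sum, Complex.re_sum]
  rw [Finset.sum_comm]
  simp only [τ.2.2.2]

/-- `x̂(τ) = τ(x)` for `x` in `V(A)`. -/
def V.hat (x : V A) (τ : T A) : ℝ :=
  Quotient.lift (fun p : ProjMat A => mtr τ p.mat) (fun p q h => by
    obtain ⟨v, h₁, h₂⟩ := h
    show mtr τ p.mat = mtr τ q.mat
    rw [← h₁, ← h₂]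
    exact mtr_comm τ _ _) x

/-- A function on `T(A)` is affine if it respects convex combinations. -/
def IsAffine (f : T A → ℝ) : Prop :=
  ∀ (σ ρ υ : T A) (t : ℝ), 0 ≤ t → t ≤ 1 →
    υ.1 = (t : ℂ) • σ.1 + ((1 - t : ℝ) : ℂ) • ρ.1 → f υ = t * f σ + (1 - t) * f ρ

variable (A) in
/-- `LAff_b(T(A))⁺⁺`: the bounded, strictly positive, lower semicontinuous affine functions on
`T(A)`. -/
structure LAff where
  /-- the function -/
  toFun : T A → ℝ
  affine : IsAffine toFun
  lsc : LowerSemicontinuous toFun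
  bounded : ∃ C : ℝ, ∀ τ, |toFun τ| ≤ C
  pos : ∀ τ, 0 < toFun τ

variable (A) in
/-- The disjoint union `W̃(A) = V(A) ⊔ LAff_b(T(A))⁺⁺`. -/
inductive WTilde : Type u
  | proj (x : V A) : WTilde
  | aff (f : LAff A) : WTilde

/-- The order on `W̃(A)`. -/
protected def WTilde.le : WTilde A → WTilde A → Prop
  | .proj x, .proj y => x ≤ y
  | .aff f, .aff g => ∀ τ, f.toFun τ ≤ g.toFun τ
  | .proj x, .aff g => ∀ τ, x.hat τ < g.toFun τ
  | .aff f, .proj y => ∀ τ, f.toFun τ ≤ y.hat τ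

instance : LE (WTilde A) := ⟨WTilde.le⟩

/-- A positive matrix is purely positive if it is not Cuntz equivalent to a projection in
`M_∞(A)`. -/
def PurelyPositive (a : PosMat A) : Prop := ∀ p : ProjMat A, W.mk a ≠ W.mk p.toPosMat

/-- The power `b ^ r` of a positive element `b` of a C⋆-algebra, by functional calculus. -/
def posPow {B : Type u} [CStarAlgebra B] [PartialOrder B] [StarOrderedRing B] (b : B) (r : ℝ≥0) :
    B :=
  b ^ r

/-- The power `a ^ r` in `M_n(A)` of a positive matrix `a`. -/
def PosMat.pow (a : PosMat A) (r : ℝ≥0) : MatC a.size a.size A :=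
  @posPow (MatC a.size a.size A) CStarMatrix.instCStarAlgebra CStarMatrix.instPartialOrder
    CStarMatrix.instStarOrderedRing a.mat r

/-- `DimValue τ a r` says `d_τ(a) = r`, where `d_τ(a) = lim_k τ(a^{1/k})`. -/
def DimValue (τ : T A) (a : PosMat A) (r : ℝ) : Prop :=
  Filter.Tendsto (fun k : ℕ => mtr τ (a.pow ((k : ℝ≥0) + 1)⁻¹)) Filter.atTop (𝓝 r)

/-- The graph of the canonical map `φ : W(A) → W̃(A)`: `φ ⟨p⟩ = [p]` for every projection `p`, and
`φ ⟨a⟩ = (τ ↦ d_τ(a))` for every purely positive `a`. -/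
inductive CanonicalMap : W A → WTilde A → Prop
  | proj (p : ProjMat A) : CanonicalMap (W.mk p.toPosMat) (WTilde.proj (V.mk p))
  | aff (a : PosMat A) (ha : PurelyPositive a) (f : LAff A)
      (hf : ∀ τ, DimValue τ a (f.toFun τ)) : CanonicalMap (W.mk a) (WTilde.aff f)

end Traces

/-! ### Classes of C⋆-algebras -/

section Classes

variable (A : Type u) [CStarAlgebra A]

/-- `A` is simple: it is nonzero and has no closed two-sided ideals other than `0` and `A`. -/
def IsSimpleCStar : Prop :=
  Nontrivial A ∧ ∀ I : TwoSidedIdeal A, IsClosed (I : Set A) → I = ⊥ ∨ I = ⊤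

/-- `A` is stably finite: every isometry in every `M_n(A)` is a unitary. -/
def IsStablyFinite : Prop :=
  ∀ (n : ℕ) (v : MatC n n A), star v * v = 1 → v * star v = 1

variable [PartialOrder A] [StarOrderedRing A]

/-- `A` is exact: it has a faithful representation on a Hilbert space that is nuclear, that is, a
point-norm limit of maps that factor through matrix algebras by completely positive
contractions. -/
def IsExact : Prop :=
  ∃ (H : Type u) (_ : NormedAddCommGroup H) (_ : InnerProductSpace ℂ H) (_ : CompleteSpace H)
    (π : A →⋆ₐ[ℂ] (H →L[ℂ] H)), Function.Injective π ∧
    ∀ (F : Finset A) (ε : ℝ), 0 < ε →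
      ∃ (n : ℕ) (φ : A →CP MatC n n ℂ) (ψ : MatC n n ℂ →CP (H →L[ℂ] H)),
        (∀ a, ‖φ a‖ ≤ ‖a‖) ∧ (∀ x, ‖ψ x‖ ≤ ‖x‖) ∧ ∀ a ∈ F, ‖ψ (φ a) - π a‖ < ε

end Classes

/-! ### Choquet simplices -/

section Simplex

variable {E : Type u} [AddCommGroup E] [Module ℝ E]

/-- The cone `{(t x, t) : t ≥ 0, x ∈ K}` in `E × ℝ`, which has `K × {1}` as a base. -/
def coneOver (K : Set E) : Set (E × ℝ) :=
  {z | ∃ t : ℝ, 0 ≤ t ∧ ∃ x ∈ K, z = (t • x, t)}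

/-- `C`, ordered by `x ≤ y` iff `y - x ∈ C`, is a lattice: any two elements of `C` have a least
upper bound and a greatest lower bound in `C`. -/
def IsLatticeCone {F : Type*} [AddCommGroup F] (C : Set F) : Prop :=
  ∀ x ∈ C, ∀ y ∈ C,
    (∃ s ∈ C, s - x ∈ C ∧ s - y ∈ C ∧ ∀ u ∈ C, u - x ∈ C → u - y ∈ C → u - s ∈ C) ∧
    (∃ i ∈ C, x - i ∈ C ∧ y - i ∈ C ∧ ∀ u ∈ C, x - u ∈ C → y - u ∈ C → i - u ∈ C)

/-- A Choquet simplex: a nonempty compact convex subset `K` of a locally convex Hausdorff space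
such that the cone over `K` is a lattice in its own order. -/
def IsChoquetSimplex [TopologicalSpace E] [IsTopologicalAddGroup E] [ContinuousSMul ℝ E]
    [LocallyConvexSpace ℝ E] [T2Space E] (K : Set E) : Prop :=
  K.Nonempty ∧ IsCompact K ∧ Convex ℝ K ∧ IsLatticeCone (coneOver K)

end Simplex

end CuntzDim

end

/-! A dimension function turns out to be the same thing as a normalised positive additive functional
on a cone of affine functions on `T A`, and such functionals form a lattice because `T A` is itself
a simplex.

First, sums in `W A` must be read through `φ`, which is only assumed to preserve order. Every `d_τ`
is additive and monotone on `W A`, and by simplicity every trace is faithful. Hence if `a ⊕ b` is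
equivalent to a projection, then `d_τ` does not drop when `a` is replaced by `(a - δ)₊` for a small
`δ`. So the spectrum of `a` omits `(0, δ)`, and `a` is itself equivalent to a projection
(`exists_projection_of_add_eq`). Purely positive classes therefore absorb arbitrary summands, and
`cls φ f + x` is the class with rank function `f + x.rk` (`exists_cls_add_eq`). Taking `f = 1` and
cancelling in the reals, `s x` depends only on `x.rk`, also when `x` is the class of a projection.
Thus `s` extends to an additive functional `induced φ s` on `affCone A`, the nonnegative differences
of elements of `LAff A`, and conversely each such functional restricts to `W A` along ranks.

Second, `affCone A` has the refinement property. In the GNS representation of a trace, the traces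
below it are given by positive operators that commute with one another. Products of these operators
refine two decompositions of the trace (`hasRefinement_posTraces`). Consequently the infimal
convolution of two elements of `LAff A`, extended homogeneously to the cone of traces, is again
affine; weak-⋆ compactness makes it lower semicontinuous and strictly positive. So `LAff A` has
greatest affine minorants, which yield refinements in `affCone A` (`hasRefinement_affCone`).

Finally, the Riesz-Kantorovich formula, once more an infimal convolution, gives the infimum `i` of
two additive functionals on a refinement monoid, and `s + s' - i` is their supremum. Compactness of
`DF A` follows from the bound `le_mul_unit`. -/

open scoped CStarAlgebra ComplexOrder NNReal Topology

noncomputable section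

namespace CuntzDim

universe u

set_option linter.unusedSectionVars false

/-! ### Resolvent cut-offs and their comparison with roots -/

section Cut

variable {B : Type u} [CStarAlgebra B]

/-- The element `1 - (1 + c a)⁻¹` attached to a positive element `a`, by functional calculus. -/
def cut (c : ℝ) (a : B) : B := cfc (fun x : ℝ => 1 - (1 + c * x)⁻¹) a

variable [PartialOrder B] [StarOrderedRing B]

theorem spectrum_nonneg {a : B} (ha : 0 ≤ a) {x : ℝ} (hx : x ∈ spectrum ℝ a) : 0 ≤ x :=
  spectrum_nonneg_of_nonneg ha hx

theorem le_smul_one_of_norm_le {a : B} (ha : IsSelfAdjoint a) {r : ℝ} (hr : ‖a‖ ≤ r) :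
    a ≤ r • 1 := by
  have h := ha.le_algebraMap_norm_self
  rw [Algebra.algebraMap_eq_smul_one] at h
  exact h.trans (smul_le_smul_of_nonneg_right hr zero_le_one)

theorem continuousOn_cut {a : B} (ha : 0 ≤ a) {c : ℝ} (hc : 0 ≤ c) :
    ContinuousOn (fun x : ℝ => 1 - (1 + c * x)⁻¹) (spectrum ℝ a) := by
  refine continuousOn_const.sub (ContinuousOn.inv₀ (by fun_prop) fun x hx => ?_)
  have := mul_nonneg hc (spectrum_nonneg ha hx)
  positivity

theorem isStrictlyPositive_one_add_smul {a : B} (ha : 0 ≤ a) {c : ℝ} (hc : 0 ≤ c) :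
    IsStrictlyPositive (1 + c • a) :=
  IsStrictlyPositive.add_nonneg isStrictlyPositive_one (smul_nonneg hc ha)

theorem cut_eq_one_sub_inverse {a : B} (ha : 0 ≤ a) {c : ℝ} (hc : 0 ≤ c) :
    cut c a = 1 - Ring.inverse (1 + c • a) := by
  have hs : IsSelfAdjoint a := .of_nonneg ha
  have hcont : ContinuousOn (fun x : ℝ => (1 + c * x)⁻¹) (spectrum ℝ a) := by
    refine ContinuousOn.inv₀ (by fun_prop) fun x hx => ?_
    have := mul_nonneg hc (spectrum_nonneg ha hx)
    positivity
  rw [cut, cfc_sub _ _ a continuousOn_const hcont, cfc_const_one ℝ a, cfc_inv _ a]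
  · rw [cfc_add a _ _, cfc_const_one ℝ a, cfc_const_mul_id c a]
  · intro x hx
    have := mul_nonneg hc (spectrum_nonneg ha hx)
    positivity

/-- Inversion is operator antitone, so this cut-off, unlike a general continuous function, respects
the order between elements that do not commute. -/
theorem cut_mono {a b : B} (ha : 0 ≤ a) (hab : a ≤ b) {c : ℝ} (hc : 0 ≤ c) :
    cut c a ≤ cut c b := by
  rw [cut_eq_one_sub_inverse ha hc, cut_eq_one_sub_inverse (ha.trans hab) hc]
  refine sub_le_sub_left (CStarAlgebra.ringInverse_le_ringInverse ?_
    (isStrictlyPositive_one_add_smul ha hc)) 1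
  gcongr

theorem cut_nonneg {a : B} (ha : 0 ≤ a) {c : ℝ} (hc : 0 ≤ c) : 0 ≤ cut c a := by
  refine cfc_nonneg fun x hx => ?_
  have := mul_nonneg hc (spectrum_nonneg ha hx)
  rw [sub_nonneg]
  exact inv_le_one_of_one_le₀ (by linarith)

theorem cut_le_one {a : B} (ha : 0 ≤ a) {c : ℝ} (hc : 0 ≤ c) : cut c a ≤ 1 := by
  refine cfc_le_one _ _ fun x hx => ?_
  have := mul_nonneg hc (spectrum_nonneg ha hx)
  have : 0 ≤ (1 + c * x)⁻¹ := by positivity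
  linarith

theorem cut_mono_left {a : B} (ha : 0 ≤ a) {c d : ℝ} (hc : 0 ≤ c) (hcd : c ≤ d) :
    cut c a ≤ cut d a := by
  refine cfc_mono (fun x hx => ?_) (continuousOn_cut ha hc) (continuousOn_cut ha (hc.trans hcd))
  have hx := spectrum_nonneg ha hx
  have := mul_nonneg hc hx
  gcongr

theorem cut_smul {a : B} (ha : 0 ≤ a) {c r : ℝ} (hc : 0 ≤ c) (hr : 0 ≤ r) :
    cut c (r • a) = cut (c * r) a := by
  rw [cut_eq_one_sub_inverse (smul_nonneg hr ha) hc, cut_eq_one_sub_inverse ha (mul_nonneg hc hr),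
    smul_smul]

/-- On `[0, ∞)` the function `1 - (1 + c x)⁻¹` has slope at most `c`. This absorbs the norm error in
Cuntz subequivalence. -/
theorem cut_add_le {a : B} (ha : 0 ≤ a) {c ε : ℝ} (hc : 0 ≤ c) (hε : 0 ≤ ε) :
    cut c (a + ε • 1) ≤ cut c a + (c * ε) • 1 := by
  have hs : IsSelfAdjoint a := .of_nonneg ha
  have h1 : a + ε • 1 = cfc (fun x : ℝ => x + ε) a := by
    rw [cfc_add a _ _, cfc_id' ℝ a, cfc_const ε a, Algebra.algebraMap_eq_smul_one]
  have h2 : cut c a + (c * ε) • 1 = cfc (fun x : ℝ => 1 - (1 + c * x)⁻¹ + c * ε) a := by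
    rw [cfc_add a _ _ (continuousOn_cut ha hc), cfc_const _ a, Algebra.algebraMap_eq_smul_one,
      cut]
  have hcont : ContinuousOn (fun x : ℝ => 1 - (1 + c * x)⁻¹) ((fun x => x + ε) '' spectrum ℝ a) := by
    refine continuousOn_const.sub (ContinuousOn.inv₀ (by fun_prop) ?_)
    rintro _ ⟨x, hx, rfl⟩
    have := mul_nonneg hc (add_nonneg (spectrum_nonneg ha hx) hε)
    positivity
  rw [h2, h1, cut, ← cfc_comp' (fun x : ℝ => 1 - (1 + c * x)⁻¹) (fun x => x + ε) a hcont]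
  refine cfc_mono (fun x hx => ?_) (hcont.comp (by fun_prop) fun x hx => ⟨x, hx, rfl⟩)
    ((continuousOn_cut ha hc).add continuousOn_const)
  have hx := spectrum_nonneg ha hx
  have h3 := mul_nonneg hc hx
  have h4 := mul_nonneg hc hε
  have h5 : (1 + c * x)⁻¹ - (1 + c * (x + ε))⁻¹ ≤ c * ε := by
    have e : (1 + c * x)⁻¹ - (1 + c * (x + ε))⁻¹ = c * ε / ((1 + c * x) * (1 + c * (x + ε))) := by
      have : 1 + c * x ≠ 0 := by positivity
      have : 1 + c * (x + ε) ≠ 0 := by positivity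
      field_simp
      ring
    rw [e]
    refine div_le_self h4 ?_
    nlinarith
  linarith

theorem continuousOn_rpow (r : ℝ≥0) (s : Set ℝ) :
    ContinuousOn (fun x : ℝ => x ^ (r : ℝ)) s :=
  fun _ _ => (Real.continuousAt_rpow_const _ _ (Or.inr r.2)).continuousWithinAt

theorem posPow_eq_cfc {a : B} (ha : 0 ≤ a) {r : ℝ≥0} (hr : 0 < r) :
    posPow a r = cfc (fun x : ℝ => x ^ (r : ℝ)) a := by
  rw [posPow, CFC.nnrpow_eq_cfcₙ_real a r ha]
  exact cfcₙ_eq_cfc (continuousOn_rpow r _) (Real.zero_rpow (by exact_mod_cast hr.ne'))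

/-- With `y = c x`, one has `y / (1 + y) ≤ min(y, 1) ≤ y ^ r` for `0 < r ≤ 1`. Together with
`exists_posPow_le` this shows that resolvents and roots compute the same dimension. -/
theorem cut_le_smul_posPow {a : B} (ha : 0 ≤ a) {c : ℝ} (hc : 0 ≤ c) {r : ℝ≥0} (hr : 0 < r)
    (hr1 : r ≤ 1) : cut c a ≤ c ^ (r : ℝ) • posPow a r := by
  rw [posPow_eq_cfc ha hr, ← cfc_const_mul _ _ a (continuousOn_rpow r _)]
  refine cfc_mono (fun x hx => ?_) (continuousOn_cut ha hc)
    (continuousOn_const.mul (continuousOn_rpow r _))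
  have hx := spectrum_nonneg ha hx
  rw [← Real.mul_rpow hc hx]
  set y := c * x with hy
  have hy0 : 0 ≤ y := mul_nonneg hc hx
  have h0 : (0:ℝ) < r := by exact_mod_cast hr
  have h1 : (r : ℝ) ≤ 1 := by exact_mod_cast hr1
  have e : 1 - (1 + y)⁻¹ = y / (1 + y) := by field_simp; ring
  rw [e]
  rcases le_total y 1 with h | h
  · calc y / (1 + y) ≤ y := div_le_self hy0 (by linarith)
      _ = y ^ (1 : ℝ) := (Real.rpow_one y).symm
      _ ≤ y ^ (r : ℝ) := Real.rpow_le_rpow_of_exponent_ge' hy0 h h0.le h1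
  · calc y / (1 + y) ≤ 1 := by rw [div_le_one (by positivity)]; linarith
      _ ≤ y ^ (r : ℝ) := Real.one_le_rpow h h0.le

theorem exists_posPow_le {a : B} (ha : 0 ≤ a) {C : ℝ} (hC : 1 ≤ C) (haC : ‖a‖ ≤ C) {r : ℝ≥0}
    (hr : 0 < r) {η : ℝ} (hη : 0 < η) :
    ∃ n : ℕ, posPow a r ≤ C ^ (r : ℝ) • cut (n + 1 : ℝ) a + η • 1 := by
  have h0 : (0:ℝ) < r := by exact_mod_cast hr
  -- For `x ≤ δ` the power `x ^ r` is at most `η`. For `x ≥ δ` the cut-off misses `1` by less than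
  -- `1 / (n δ)`, and `n` is chosen so that `C ^ r` times this is at most `η`.
  set δ : ℝ := η ^ ((r : ℝ)⁻¹) with hδ
  have hδ0 : 0 < δ := Real.rpow_pos_of_pos hη _
  obtain ⟨n, hn⟩ := exists_nat_gt (C ^ (r : ℝ) / (δ * η))
  refine ⟨n, ?_⟩
  have hc : (0 : ℝ) ≤ n + 1 := by positivity
  have hs : IsSelfAdjoint a := .of_nonneg ha
  have hcc := continuousOn_cut ha hc
  have e : C ^ (r : ℝ) • cut (n + 1 : ℝ) a + η • 1 =
      cfc (fun x : ℝ => C ^ (r : ℝ) * (1 - (1 + (n + 1) * x)⁻¹) + η) a := by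
    rw [cfc_add a (fun x : ℝ => C ^ (r : ℝ) * (1 - (1 + (n + 1) * x)⁻¹)) _
      (continuousOn_const.mul hcc), cfc_const _ a, Algebra.algebraMap_eq_smul_one,
      cfc_const_mul _ _ a hcc, cut]
  rw [e, posPow_eq_cfc ha hr]
  refine cfc_mono (fun x hx => ?_) (continuousOn_rpow r _)
    ((continuousOn_const.mul hcc).add continuousOn_const)
  have hx0 := spectrum_nonneg ha hx
  have hxC : x ≤ C := by
    have hB : Nontrivial B := by
      by_contra h
      rw [not_nontrivial_iff_subsingleton] at h
      simp [spectrum.of_subsingleton] at hx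
    have := spectrum.norm_le_norm_of_mem hx
    rw [Real.norm_eq_abs, abs_of_nonneg hx0] at this
    exact this.trans haC
  have hxr : x ^ (r : ℝ) ≤ C ^ (r : ℝ) := Real.rpow_le_rpow hx0 hxC h0.le
  have hmx : (0 : ℝ) ≤ (n + 1) * x := by positivity
  have hinv : (1 + (n + 1) * x)⁻¹ ≤ 1 := inv_le_one_of_one_le₀ (by linarith)
  have hinv0 : 0 ≤ (1 + (n + 1) * x)⁻¹ := by positivity
  have hCr : 0 ≤ C ^ (r : ℝ) := by positivity
  rcases le_total x δ with h | h
  · have : x ^ (r : ℝ) ≤ η := by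
      calc x ^ (r : ℝ) ≤ δ ^ (r : ℝ) := Real.rpow_le_rpow hx0 h h0.le
        _ = η := Real.rpow_inv_rpow hη.le h0.ne'
    nlinarith [mul_nonneg hCr (sub_nonneg.2 hinv)]
  · have : C ^ (r : ℝ) * (1 + (n + 1) * x)⁻¹ ≤ η := by
      rw [mul_inv_le_iff₀ (by positivity)]
      rw [div_lt_iff₀ (by positivity)] at hn
      have h2 : (n : ℝ) * (δ * η) ≤ η * ((n + 1) * x) := by
        have : (n : ℝ) * δ ≤ (n + 1) * x := by nlinarith
        nlinarith
      nlinarith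
    nlinarith

end Cut

/-! ### The rank of a positive element with respect to a positive functional -/

section Rank

variable {B : Type u} [CStarAlgebra B] [PartialOrder B] [StarOrderedRing B]

/-- The rank `sup_n Re t(1 - (1 + (n + 1) a)⁻¹)` of a positive element `a` with respect to a
positive functional `t`. -/
def rankOf (t : B →ₗ[ℂ] ℂ) (a : B) : ℝ := ⨆ n : ℕ, (t (cut (n + 1 : ℝ) a)).re

variable {t : B →ₗ[ℂ] ℂ}

theorem re_apply_mono (ht : ∀ b : B, 0 ≤ b → 0 ≤ (t b).re) {a b : B} (hab : a ≤ b) :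
    (t a).re ≤ (t b).re := by
  have := ht _ (sub_nonneg.2 hab)
  rw [map_sub, Complex.sub_re] at this
  linarith

theorem re_apply_smul (r : ℝ) (b : B) : (t (r • b)).re = r * (t b).re := by
  rw [← Complex.coe_smul, map_smul, smul_eq_mul, Complex.re_ofReal_mul]

theorem bddAbove_rankOf (ht : ∀ b : B, 0 ≤ b → 0 ≤ (t b).re) {a : B} (ha : 0 ≤ a) :
    BddAbove (Set.range fun n : ℕ => (t (cut (n + 1 : ℝ) a)).re) :=
  ⟨(t 1).re, by rintro _ ⟨n, rfl⟩; exact re_apply_mono ht (cut_le_one ha (by positivity))⟩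

theorem re_cut_le_rankOf (ht : ∀ b : B, 0 ≤ b → 0 ≤ (t b).re) {a : B} (ha : 0 ≤ a) {c : ℝ}
    (hc : 0 ≤ c) : (t (cut c a)).re ≤ rankOf t a := by
  obtain ⟨n, hn⟩ := exists_nat_ge c
  exact (re_apply_mono ht (cut_mono_left ha hc (by linarith))).trans
    (le_ciSup (bddAbove_rankOf ht ha) n)

theorem rankOf_le_of_forall_cut {a : B} {M : ℝ}
    (h : ∀ c : ℝ, 0 ≤ c → (t (cut c a)).re ≤ M) : rankOf t a ≤ M :=
  ciSup_le fun _ => h _ (by positivity)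

theorem rankOf_nonneg (ht : ∀ b : B, 0 ≤ b → 0 ≤ (t b).re) {a : B} (ha : 0 ≤ a) :
    0 ≤ rankOf t a :=
  (ht _ (cut_nonneg ha zero_le_one)).trans (re_cut_le_rankOf ht ha zero_le_one)

theorem rankOf_le_one (ht : ∀ b : B, 0 ≤ b → 0 ≤ (t b).re) {a : B} (ha : 0 ≤ a) :
    rankOf t a ≤ (t 1).re :=
  rankOf_le_of_forall_cut fun _ hc => re_apply_mono ht (cut_le_one ha hc)

theorem rankOf_mono (ht : ∀ b : B, 0 ≤ b → 0 ≤ (t b).re) {a b : B} (ha : 0 ≤ a) (hab : a ≤ b) :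
    rankOf t a ≤ rankOf t b :=
  rankOf_le_of_forall_cut fun _ hc =>
    (re_apply_mono ht (cut_mono ha hab hc)).trans (re_cut_le_rankOf ht (ha.trans hab) hc)

theorem tendsto_cut_rankOf (ht : ∀ b : B, 0 ≤ b → 0 ≤ (t b).re) {a : B} (ha : 0 ≤ a) :
    Filter.Tendsto (fun n : ℕ => (t (cut (n + 1 : ℝ) a)).re) Filter.atTop (𝓝 (rankOf t a)) :=
  tendsto_atTop_ciSup (fun m n h => re_apply_mono ht
    (cut_mono_left ha (by positivity) (by gcongr))) (bddAbove_rankOf ht ha)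

theorem re_posPow_le (ht : ∀ b : B, 0 ≤ b → 0 ≤ (t b).re) {a : B} (ha : 0 ≤ a) {C : ℝ}
    (hC : 1 ≤ C) (haC : ‖a‖ ≤ C) {r : ℝ≥0} (hr : 0 < r) :
    (t (posPow a r)).re ≤ C ^ (r : ℝ) * rankOf t a := by
  have h1 : 0 ≤ (t 1).re := ht 1 zero_le_one
  refine le_of_forall_pos_le_add fun ε hε => ?_
  obtain ⟨n, hn⟩ := exists_posPow_le ha hC haC hr (η := ε / ((t 1).re + 1)) (by positivity)
  have h2 := re_apply_mono ht hn
  rw [map_add, Complex.add_re, re_apply_smul, re_apply_smul] at h2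
  have h3 := re_cut_le_rankOf ht ha (c := n + 1) (by positivity)
  have h4 : ε / ((t 1).re + 1) * (t 1).re ≤ ε := by
    rw [div_mul_eq_mul_div, div_le_iff₀ (by positivity)]
    nlinarith
  have h5 : C ^ (r : ℝ) * (t (cut (n + 1 : ℝ) a)).re ≤ C ^ (r : ℝ) * rankOf t a := by gcongr
  linarith

/-- The rank is the limit of the values at the roots of the element. -/
theorem tendsto_posPow_rankOf (ht : ∀ b : B, 0 ≤ b → 0 ≤ (t b).re) {a : B} (ha : 0 ≤ a) :
    Filter.Tendsto (fun k : ℕ => (t (posPow a ((k : ℝ≥0) + 1)⁻¹)).re) Filter.atTop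
      (𝓝 (rankOf t a)) := by
  have hlim (c : ℝ) (hc : 0 < c) : Filter.Tendsto
      (fun k : ℕ => c ^ ((((k : ℝ≥0) + 1)⁻¹ : ℝ≥0) : ℝ)) Filter.atTop (𝓝 1) := by
    have h1 : Filter.Tendsto (fun k : ℕ => ((((k : ℝ≥0) + 1)⁻¹ : ℝ≥0) : ℝ)) Filter.atTop (𝓝 0) := by
      simpa using tendsto_one_div_add_atTop_nhds_zero_nat (𝕜 := ℝ)
    simpa using Filter.Tendsto.rpow (tendsto_const_nhds (x := c)) h1 (Or.inl hc.ne')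
  have hpos (k : ℕ) : 0 < ((k : ℝ≥0) + 1)⁻¹ := by positivity
  have hle (k : ℕ) : ((k : ℝ≥0) + 1)⁻¹ ≤ 1 := inv_le_one_of_one_le₀ (by simp)
  rw [tendsto_order]
  constructor
  · intro y hy
    obtain ⟨n, hn⟩ := exists_lt_of_lt_ciSup hy
    have hc : (0 : ℝ) < n + 1 := by positivity
    -- The factor `(n + 1) ^ (1 / (k + 1))` lost in `cut_le_smul_posPow` tends to `1` for fixed `n`;
    -- likewise below for the factor `(‖a‖ + 1) ^ (1 / (k + 1))`.
    have h1 := (hlim _ hc).mul_const y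
    rw [one_mul] at h1
    filter_upwards [h1.eventually_lt_const hn] with k hk
    have h2 := re_apply_mono ht (cut_le_smul_posPow ha hc.le (hpos k) (hle k))
    rw [re_apply_smul] at h2
    have h3 : 0 < (n + 1 : ℝ) ^ ((((k : ℝ≥0) + 1)⁻¹ : ℝ≥0) : ℝ) := Real.rpow_pos_of_pos hc _
    exact lt_of_mul_lt_mul_left (hk.trans_le h2) h3.le
  · intro y hy
    have hC : (0 : ℝ) < ‖a‖ + 1 := by positivity
    have h1 := (hlim _ hC).mul_const (rankOf t a)
    rw [one_mul] at h1
    filter_upwards [h1.eventually_lt_const hy] with k hk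
    exact (re_posPow_le ht ha (by simp) (by simp) (hpos k)).trans_lt hk

end Rank

/-! ### The dimension `d_τ` on matrices and its invariance under Cuntz subequivalence -/

section MatrixRank

variable {A : Type u} [CStarAlgebra A]

theorem inverse_eq_of_mul_eq_one {R : Type*} [MonoidWithZero R] {x y : R} (h : x * y = 1)
    (h' : y * x = 1) : Ring.inverse x = y :=
  Ring.inverse_unit ⟨x, y, h, h'⟩

theorem dsum_add {k l m n : ℕ} (a a' : MatC k l A) (b b' : MatC m n A) :
    dsum (a + a') (b + b') = dsum a b + dsum a' b' := by
  ext i j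
  refine Fin.addCases (fun i => ?_) (fun i => ?_) i <;>
  refine Fin.addCases (fun j => ?_) (fun j => ?_) j <;> simp [dsum]

theorem dsum_smul {k l m n : ℕ} (c : ℝ) (a : MatC k l A) (b : MatC m n A) :
    dsum (c • a) (c • b) = c • dsum a b := by
  ext i j
  refine Fin.addCases (fun i => ?_) (fun i => ?_) i <;>
  refine Fin.addCases (fun j => ?_) (fun j => ?_) j <;> simp [dsum]

theorem dsum_one {m n : ℕ} : dsum (1 : MatC m m A) (1 : MatC n n A) = 1 := by
  ext i j
  refine Fin.addCases (fun i => ?_) (fun i => ?_) i <;>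
  refine Fin.addCases (fun j => ?_) (fun j => ?_) j <;>
  simp [dsum, CStarMatrix.one_apply, Fin.ext_iff] <;> omega

variable [PartialOrder A] [StarOrderedRing A]

/-- For a rectangular matrix `x`, the product `x⋆ x` is positive. -/
theorem conjTranspose_mul_self_nonneg {m n : ℕ} (x : MatC m n A) : 0 ≤ x.conjTranspose * x := by
  rcases Nat.eq_zero_or_pos n with rfl | hn
  · refine le_of_eq ?_
    ext i
    exact i.elim0
  -- `R k` is the square matrix whose top row is the `k`-th row of `x`, all other rows being zero.
  -- Positivity is thereby reduced to square matrices; a top row exists because `0 < n`.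
  let R (k : Fin m) : MatC n n A :=
    CStarMatrix.ofMatrix fun i j => if i = (⟨0, hn⟩ : Fin n) then x k j else 0
  have hR (k : Fin m) (i j : Fin n) : R k i j = if i = ⟨0, hn⟩ then x k j else 0 := rfl
  have h : x.conjTranspose * x = ∑ k, star (R k) * R k := by
    ext i j
    have e : (∑ k, star (R k) * R k) i j = ∑ k, (star (R k) * R k) i j :=
      map_sum (⟨⟨fun M : MatC n n A => M i j, rfl⟩, fun _ _ => rfl⟩ : MatC n n A →+ A)
        (fun k => star (R k) * R k) Finset.univ
    rw [e, CStarMatrix.mul_apply]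
    refine Finset.sum_congr rfl fun k _ => ?_
    have e' : (star (R k) * R k) i j = ∑ l, star (R k l i) * R k l j := CStarMatrix.mul_apply
    rw [e', Finset.sum_eq_single ⟨0, hn⟩]
    · simp [hR]
    · intro l _ hl
      simp [hR, hl]
    · simp
  rw [h]
  exact Finset.sum_nonneg fun k _ => star_mul_self_nonneg _

theorem mul_conjTranspose_self_nonneg {m n : ℕ} (x : MatC m n A) : 0 ≤ x * x.conjTranspose := by
  simpa only [mat_conjTranspose_conjTranspose] using conjTranspose_mul_self_nonneg x.conjTranspose

/-- The extension of a tracial state to matrices, as a linear functional. -/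
def mtrL (τ : T A) (n : ℕ) : MatC n n A →ₗ[ℂ] ℂ where
  toFun a := ∑ i, τ.1 (a i i)
  map_add' a b := by simp [Finset.sum_add_distrib]
  map_smul' c a := by simp [Finset.mul_sum]

theorem re_mtrL (τ : T A) {n : ℕ} (a : MatC n n A) : (mtrL τ n a).re = mtr τ a := by
  simp [mtrL, mtr]

theorem mtr_star_mul_self (τ : T A) {n : ℕ} (y : MatC n n A) :
    mtr τ (star y * y) = ∑ i, ∑ k, (τ.1 (star (y k i) * y k i)).re := by
  simp [mtr, CStarMatrix.mul_apply, CStarMatrix.star_apply]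

theorem re_apply_star_mul_self_nonneg (τ : T A) (x : A) : 0 ≤ (τ.1 (star x * x)).re :=
  (Complex.nonneg_iff.1 (τ.2.1 _ (star_mul_self_nonneg x))).1

theorem mtr_nonneg (τ : T A) {n : ℕ} {a : MatC n n A} (ha : 0 ≤ a) : 0 ≤ mtr τ a := by
  obtain ⟨y, rfl⟩ := exists_star_mul_self_of_nonneg (h := CStarMatrix.instStarOrderedRing) ha
  rw [mtr_star_mul_self]
  exact Finset.sum_nonneg fun i _ => Finset.sum_nonneg fun k _ => re_apply_star_mul_self_nonneg τ _

theorem re_mtrL_nonneg (τ : T A) {n : ℕ} (a : MatC n n A) (ha : 0 ≤ a) :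
    0 ≤ (mtrL τ n a).re := by
  rw [re_mtrL]
  exact mtr_nonneg τ ha

theorem mtr_one (τ : T A) (n : ℕ) : mtr τ (1 : MatC n n A) = n := by
  simp [mtr, τ.2.2.1]

theorem mtr_dsum (τ : T A) {m n : ℕ} (a : MatC m m A) (b : MatC n n A) :
    mtr τ (dsum a b) = mtr τ a + mtr τ b := by
  simp [mtr, Fin.sum_univ_add, dsum]

theorem mtr_sub (τ : T A) {n : ℕ} (a b : MatC n n A) :
    mtr τ (a - b) = mtr τ a - mtr τ b := by
  rw [← re_mtrL, map_sub, Complex.sub_re, re_mtrL, re_mtrL]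

theorem mtr_smul (τ : T A) {n : ℕ} (c : ℝ) (a : MatC n n A) :
    mtr τ (c • a) = c * mtr τ a := by
  rw [← re_mtrL, ← re_mtrL]
  exact re_apply_smul c a

/-- The dimension `d_τ(a)` of a positive matrix. -/
def rank (τ : T A) {n : ℕ} (a : MatC n n A) : ℝ := rankOf (mtrL τ n) a

theorem mat_cut_eq_one_sub_inverse {n : ℕ} {a : MatC n n A} (ha : 0 ≤ a) {c : ℝ} (hc : 0 ≤ c) :
    cut c a = 1 - Ring.inverse (1 + c • a) :=
  cut_eq_one_sub_inverse ha hc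

theorem mat_isUnit_one_add_smul {n : ℕ} {a : MatC n n A} (ha : 0 ≤ a) {c : ℝ} (hc : 0 ≤ c) :
    IsUnit (1 + c • a) :=
  (isStrictlyPositive_one_add_smul ha hc).isUnit

theorem cut_dsum {m n : ℕ} {a : MatC m m A} {b : MatC n n A} (ha : 0 ≤ a) (hb : 0 ≤ b) {c : ℝ}
    (hc : 0 ≤ c) : cut c (dsum a b) = dsum (cut c a) (cut c b) := by
  have ha' := mat_isUnit_one_add_smul ha hc
  have hb' := mat_isUnit_one_add_smul hb hc
  have h : Ring.inverse (1 + c • dsum a b) =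
      dsum (Ring.inverse (1 + c • a)) (Ring.inverse (1 + c • b)) := by
    have e : 1 + c • dsum a b = dsum (1 + c • a) (1 + c • b) := by
      rw [dsum_add, dsum_one, dsum_smul]
    rw [e]
    refine inverse_eq_of_mul_eq_one ?_ ?_
    · refine (dsum_mul _ _ _ _).trans ?_
      rw [← dsum_one]
      exact congrArg₂ dsum (Ring.mul_inverse_cancel _ ha') (Ring.mul_inverse_cancel _ hb')
    · refine (dsum_mul _ _ _ _).trans ?_
      rw [← dsum_one]
      exact congrArg₂ dsum (Ring.inverse_mul_cancel _ ha') (Ring.inverse_mul_cancel _ hb')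
  rw [mat_cut_eq_one_sub_inverse ha hc, mat_cut_eq_one_sub_inverse hb hc,
    mat_cut_eq_one_sub_inverse (dsum_nonneg ha hb) hc, h, sub_eq_iff_eq_add, ← dsum_add,
    sub_add_cancel, sub_add_cancel, dsum_one]

/-- The resolvents of `x x⋆` and of `x⋆ x` have the same trace. -/
theorem mtr_cut_mul_conjTranspose (τ : T A) {m n : ℕ} (x : MatC m n A) {c : ℝ} (hc : 0 ≤ c) :
    mtr τ (cut c (x * x.conjTranspose)) = mtr τ (cut c (x.conjTranspose * x)) := by
  have hl := mul_conjTranspose_self_nonneg x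
  have hr := conjTranspose_mul_self_nonneg x
  rw [mat_cut_eq_one_sub_inverse hl hc, mat_cut_eq_one_sub_inverse hr hc]
  have hu := mat_isUnit_one_add_smul hr hc
  set y := x.conjTranspose with hy
  set u := Ring.inverse (1 + c • (y * x)) with hu'
  have h1 : (1 + c • (y * x)) * u = 1 := Ring.mul_inverse_cancel _ hu
  have h2 : u * (1 + c • (y * x)) = 1 := Ring.inverse_mul_cancel _ hu
  have h1' : c • (y * x * u) = 1 - u := by
    rw [eq_sub_iff_add_eq, add_comm, ← h1, add_mul, one_mul, smul_mul_assoc]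
  have h2' : c • (u * (y * x)) = 1 - u := by
    rw [eq_sub_iff_add_eq, add_comm, ← h2, mul_add, mul_one, mul_smul_comm]
  -- The push-through identity for `(1 + c x y)⁻¹`. After it, the trace of `c x u y` is that of `c u
  -- y x = 1 - u`.
  have h : Ring.inverse (1 + c • (x * y)) = 1 - c • (x * u * y) := by
    refine inverse_eq_of_mul_eq_one ?_ ?_
    · have e : c • (x * y * (c • (x * u * y))) = c • (x * (1 - u) * y) := by
        rw [← h1']
        simp only [CStarMatrix.mul_smul, CStarMatrix.smul_mul, mat_mul_assoc]
      have e' : x * (1 - u) * y = x * y - x * u * y := by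
        rw [eq_sub_iff_add_eq, ← CStarMatrix.add_mul, ← CStarMatrix.mul_add, sub_add_cancel,
          mat_mul_one]
      rw [mul_sub, mul_one, add_mul, one_mul, smul_mul_assoc, e, e', smul_sub]
      abel
    · have e : c • ((c • (x * u * y)) * (x * y)) = c • (x * (1 - u) * y) := by
        rw [← h2']
        simp only [CStarMatrix.mul_smul, CStarMatrix.smul_mul, mat_mul_assoc]
      have e' : x * (1 - u) * y = x * y - x * u * y := by
        rw [eq_sub_iff_add_eq, ← CStarMatrix.add_mul, ← CStarMatrix.mul_add, sub_add_cancel,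
          mat_mul_one]
      rw [sub_mul, one_mul, mul_add, mul_one, mul_smul_comm, e, e', smul_sub]
      abel
  rw [h, sub_sub_cancel, mtr_smul, mat_mul_assoc, mtr_comm, ← h2', mtr_smul, mat_mul_assoc]

theorem rank_dsum (τ : T A) {m n : ℕ} {a : MatC m m A} {b : MatC n n A} (ha : 0 ≤ a)
    (hb : 0 ≤ b) : rank τ (dsum a b) = rank τ a + rank τ b := by
  refine tendsto_nhds_unique (tendsto_cut_rankOf (re_mtrL_nonneg τ) (dsum_nonneg ha hb)) ?_
  refine ((tendsto_cut_rankOf (re_mtrL_nonneg τ) ha).add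
    (tendsto_cut_rankOf (re_mtrL_nonneg τ) hb)).congr fun k => ?_
  rw [cut_dsum ha hb (by positivity), re_mtrL, re_mtrL, re_mtrL, mtr_dsum]

theorem dimValue_rank (τ : T A) (a : PosMat A) : DimValue τ a (rank τ a.mat) := by
  have := tendsto_posPow_rankOf (re_mtrL_nonneg τ) a.nonneg
  simp only [re_mtrL] at this
  exact this

theorem rank_nonneg (τ : T A) {n : ℕ} {a : MatC n n A} (ha : 0 ≤ a) : 0 ≤ rank τ a :=
  rankOf_nonneg (re_mtrL_nonneg τ) ha

theorem rank_le_size (τ : T A) {n : ℕ} {a : MatC n n A} (ha : 0 ≤ a) : rank τ a ≤ n := by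
  have h := rankOf_le_one (re_mtrL_nonneg τ) ha
  rwa [re_mtrL, mtr_one] at h

theorem rank_mono (τ : T A) {n : ℕ} {a b : MatC n n A} (ha : 0 ≤ a) (hab : a ≤ b) :
    rank τ a ≤ rank τ b :=
  rankOf_mono (re_mtrL_nonneg τ) ha hab

theorem mtr_cut_le_rank (τ : T A) {n : ℕ} {a : MatC n n A} (ha : 0 ≤ a) {c : ℝ} (hc : 0 ≤ c) :
    mtr τ (cut c a) ≤ rank τ a := by
  rw [← re_mtrL]
  exact re_cut_le_rankOf (re_mtrL_nonneg τ) ha hc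

theorem rank_le_of_forall_cut (τ : T A) {n : ℕ} {a : MatC n n A} {M : ℝ}
    (h : ∀ c : ℝ, 0 ≤ c → mtr τ (cut c a) ≤ M) : rank τ a ≤ M :=
  rankOf_le_of_forall_cut fun c hc => (re_mtrL τ _).trans_le (h c hc)

theorem mtr_mono (τ : T A) {n : ℕ} {a b : MatC n n A} (hab : a ≤ b) : mtr τ a ≤ mtr τ b := by
  have := mtr_nonneg τ (sub_nonneg.2 hab)
  rw [mtr_sub] at this
  linarith

theorem conj_nonneg {m n : ℕ} (v : MatC m n A) {b : MatC n n A} (hb : 0 ≤ b) :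
    0 ≤ v * b * v.conjTranspose := by
  obtain ⟨y, rfl⟩ := exists_star_mul_self_of_nonneg (h := CStarMatrix.instStarOrderedRing) hb
  have h := mul_conjTranspose_self_nonneg (v * y.conjTranspose)
  rw [mat_conjTranspose_mul, mat_conjTranspose_conjTranspose] at h
  simp only [mat_mul_assoc] at h ⊢
  exact h

/-- With `b = y⋆ y`, the trace identity turns `v b v⋆` into `y (v⋆ v) y⋆`, which is at most `K y
y⋆`. Operator monotonicity applies there, and the identity is used again to return to `y⋆ y`. The
factor `K` only rescales the parameter of the cut-off. -/
theorem rank_conj_le (τ : T A) {m n : ℕ} (v : MatC m n A) {b : MatC n n A} (hb : 0 ≤ b) :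
    rank τ (v * b * v.conjTranspose) ≤ rank τ b := by
  obtain ⟨y, rfl⟩ := exists_star_mul_self_of_nonneg (h := CStarMatrix.instStarOrderedRing) hb
  refine rank_le_of_forall_cut τ fun c hc => ?_
  set K : ℝ := ‖v.conjTranspose * v‖ with hK
  have hK0 : 0 ≤ K := norm_nonneg _
  have hv := conjTranspose_mul_self_nonneg v
  have hle : v.conjTranspose * v ≤ K • 1 := le_smul_one_of_norm_le (.of_nonneg hv) le_rfl
  have hconj : y * (v.conjTranspose * v) * star y ≤ K • (y * star y) := by
    have h := star_right_conjugate_le_conjugate hle y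
    rwa [mul_smul_comm, mul_one, smul_mul_assoc] at h
  have hconj0 : 0 ≤ y * (v.conjTranspose * v) * star y := star_right_conjugate_nonneg hv y
  have e1 : v * (star y * y) * v.conjTranspose =
      (v * y.conjTranspose) * (v * y.conjTranspose).conjTranspose := by
    rw [mat_conjTranspose_mul, mat_conjTranspose_conjTranspose]
    simp only [mat_mul_assoc]
    rfl
  have e2 : (v * y.conjTranspose).conjTranspose * (v * y.conjTranspose) =
      y * (v.conjTranspose * v) * star y := by
    rw [mat_conjTranspose_mul, mat_conjTranspose_conjTranspose]
    simp only [mat_mul_assoc]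
    rfl
  calc mtr τ (cut c (v * (star y * y) * v.conjTranspose))
      = mtr τ (cut c (y * (v.conjTranspose * v) * star y)) := by
        rw [e1, mtr_cut_mul_conjTranspose τ _ hc, e2]
    _ ≤ mtr τ (cut c (K • (y * star y))) := mtr_mono τ (cut_mono hconj0 hconj hc)
    _ = mtr τ (cut (c * K) (y * star y)) :=
        congrArg (mtr τ) (cut_smul (mul_star_self_nonneg y) hc hK0)
    _ = mtr τ (cut (c * K) (star y * y)) := mtr_cut_mul_conjTranspose τ y (mul_nonneg hc hK0)
    _ ≤ rank τ (star y * y) := mtr_cut_le_rank τ hb (mul_nonneg hc hK0)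

theorem rank_le_of_cuntzLE (τ : T A) {m n : ℕ} {a : MatC m m A} {b : MatC n n A} (ha : 0 ≤ a)
    (hb : 0 ≤ b) (hab : CuntzLE a b) : rank τ a ≤ rank τ b := by
  refine rank_le_of_forall_cut τ fun c hc => le_of_forall_pos_le_add fun ε hε => ?_
  obtain ⟨v, hv⟩ := hab
  -- The error in the trace will be `c η m`, which this choice keeps below `ε`; the summand `1`
  -- keeps the denominator positive.
  set η : ℝ := ε / (c * m + 1) with hη
  have hη0 : 0 < η := by positivity
  obtain ⟨k, hk⟩ := (hv.eventually_lt_const hη0).exists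
  have hd := conj_nonneg (v k) hb
  set d := v k * b * (v k).conjTranspose with hd'
  have hs : IsSelfAdjoint (a - d) := (IsSelfAdjoint.of_nonneg ha).sub (.of_nonneg hd)
  have h1 : a ≤ d + η • 1 := by
    rw [← sub_le_iff_le_add']
    exact le_smul_one_of_norm_le hs ((norm_sub_rev _ _).trans_le hk.le)
  have h2 := mtr_mono τ ((cut_mono ha h1 hc).trans (cut_add_le hd hc hη0.le))
  have h3 : mtr τ (cut c d + (c * η) • 1) = mtr τ (cut c d) + c * η * m := by
    have e : mtr τ (cut c d + (c * η) • 1) = mtr τ (cut c d) + mtr τ ((c * η) • (1 : MatC m m A)) := by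
      rw [← re_mtrL, map_add, Complex.add_re, re_mtrL, re_mtrL]
    rw [e, mtr_smul, mtr_one]
  have h4 := (mtr_cut_le_rank τ hd hc).trans (rank_conj_le τ (v k) hb)
  have h5 : c * η * m ≤ ε := by
    rw [hη, mul_div_assoc', div_mul_eq_mul_div, div_le_iff₀ (by positivity)]
    nlinarith
  have h6 : mtr τ (cut c a) ≤ mtr τ (cut c d) + c * η * m := h2.trans_eq h3
  linarith

theorem posPow_proj {B : Type u} [CStarAlgebra B] [PartialOrder B] [StarOrderedRing B] {p : B}
    (hp : IsStarProjection p) {r : ℝ≥0} (hr : 0 < r) : posPow p r = p := by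
  have hs := hp.isSelfAdjoint
  rw [posPow_eq_cfc hp.nonneg hr]
  conv_rhs => rw [← cfc_id ℝ p]
  refine cfc_congr fun x hx => ?_
  have h : x = 0 ∨ x = 1 := by
    simpa using hp.isIdempotentElem.spectrum_subset ℝ hx
  rcases h with rfl | rfl
  · exact Real.zero_rpow (by exact_mod_cast hr.ne')
  · exact Real.one_rpow _

theorem rank_proj (τ : T A) (p : ProjMat A) : rank τ p.mat = mtr τ p.mat := by
  refine tendsto_nhds_unique (dimValue_rank τ p.toPosMat) ?_
  refine tendsto_const_nhds.congr fun k => ?_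
  exact congrArg (mtr τ) (posPow_proj p.isProj (by positivity)).symm

end MatrixRank

/-! ### Spectral gaps and projections -/

section Gap

variable {B : Type u} [CStarAlgebra B]

/-- The truncation `(a - δ)₊`. -/
def trunc (δ : ℝ) (a : B) : B := cfc (fun x : ℝ => max (x - δ) 0) a

variable [PartialOrder B] [StarOrderedRing B]

theorem trunc_nonneg (δ : ℝ) (a : B) : 0 ≤ trunc δ a :=
  cfc_nonneg fun _ _ => le_max_right _ _

theorem norm_trunc_sub_le {a : B} (ha : 0 ≤ a) {δ : ℝ} (hδ : 0 ≤ δ) : ‖trunc δ a - a‖ ≤ δ := by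
  have hs : IsSelfAdjoint a := .of_nonneg ha
  have e : trunc δ a - a = cfc (fun x : ℝ => max (x - δ) 0 - x) a := by
    rw [cfc_sub _ _ a, cfc_id' ℝ a, trunc]
  rw [e]
  refine norm_cfc_le hδ fun x hx => ?_
  have := spectrum_nonneg ha hx
  rw [Real.norm_eq_abs, abs_le]
  rcases max_cases (x - δ) 0 with h | h <;> constructor <;> linarith

/-- A continuous function that is positive exactly on the interval `(0, δ)` (among `x ≥ 0`). -/
def bump (δ x : ℝ) : ℝ := max 0 (min (1 - (1 + x)⁻¹) (δ - x))

theorem continuousOn_bump {a : B} (ha : 0 ≤ a) (δ : ℝ) :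
    ContinuousOn (bump δ) (spectrum ℝ a) := by
  have h : ContinuousOn (fun x : ℝ => (1 + x)⁻¹) (spectrum ℝ a) :=
    ContinuousOn.inv₀ (by fun_prop) fun x hx => by
      have := spectrum_nonneg ha hx
      positivity
  unfold bump
  fun_prop

/-- The element obtained from `bump δ` by functional calculus. -/
def bumpOf (δ : ℝ) (a : B) : B := cfc (bump δ) a

theorem bumpOf_nonneg (δ : ℝ) (a : B) : 0 ≤ bumpOf δ a := cfc_nonneg fun _ _ => le_max_left _ _

/-- Below `δ` the truncation vanishes and the bump lies under every cut-off with parameter at least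
`1`. From `δ` on, the bump vanishes and the truncation is at most `x`. So a truncation that loses no
rank forces the functional to vanish on the bump. -/
theorem rankOf_trunc_add_le {t : B →ₗ[ℂ] ℂ} (ht : ∀ b : B, 0 ≤ b → 0 ≤ (t b).re) {a : B}
    (ha : 0 ≤ a) {δ : ℝ} (hδ : 0 ≤ δ) :
    rankOf t (trunc δ a) + (t (bumpOf δ a)).re ≤ rankOf t a := by
  have hs : IsSelfAdjoint a := .of_nonneg ha
  rw [← le_sub_iff_add_le]
  refine ciSup_le fun n => ?_
  rw [le_sub_iff_add_le]
  have hn : (1 : ℝ) ≤ n + 1 := by simp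
  have hcont : ContinuousOn (fun x : ℝ => 1 - (1 + (n + 1) * x)⁻¹)
      ((fun x => max (x - δ) 0) '' spectrum ℝ a) := by
    refine continuousOn_const.sub (ContinuousOn.inv₀ (by fun_prop) ?_)
    rintro _ ⟨x, hx, rfl⟩
    have := mul_nonneg (zero_le_one.trans hn) (le_max_right (x - δ) 0)
    positivity
  have hcont' : ContinuousOn (fun x : ℝ => 1 - (1 + (n + 1) * max (x - δ) 0)⁻¹) (spectrum ℝ a) :=
    hcont.comp (by fun_prop) fun x hx => ⟨x, hx, rfl⟩
  have hle : cut (n + 1 : ℝ) (trunc δ a) + bumpOf δ a ≤ cut (n + 1 : ℝ) a := by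
    rw [cut, trunc, bumpOf, ← cfc_comp' (fun x : ℝ => 1 - (1 + (n + 1) * x)⁻¹)
      (fun x => max (x - δ) 0) a hcont, ← cfc_add a _ _ hcont' (continuousOn_bump ha δ)]
    refine cfc_mono (fun x hx => ?_) (hcont'.add (continuousOn_bump ha δ))
      (continuousOn_cut ha (by positivity))
    have hx0 := spectrum_nonneg ha hx
    rcases le_total x δ with h | h
    · have h1 : max (x - δ) 0 = 0 := max_eq_right (by linarith)
      have h2 : (1 + (n + 1) * x)⁻¹ ≤ (1 + x)⁻¹ := by
        gcongr
        nlinarith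
      have h3 : (1 + x)⁻¹ ≤ 1 := inv_le_one_of_one_le₀ (by linarith)
      have h4 : bump δ x ≤ 1 - (1 + x)⁻¹ := max_le (by linarith) (min_le_left _ _)
      simp only [h1, mul_zero, add_zero, inv_one, sub_self, zero_add]
      linarith
    · have h1 : max (x - δ) 0 = x - δ := max_eq_left (by linarith)
      have h2 : bump δ x = 0 :=
        max_eq_left ((min_le_right _ _).trans (by linarith))
      rw [h1, h2, add_zero]
      have h3 : (0 : ℝ) ≤ x - δ := by linarith
      gcongr
      linarith
  have h := (re_apply_mono ht hle).trans (le_ciSup (bddAbove_rankOf ht ha) n)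
  rwa [map_add, Complex.add_re] at h

theorem eq_zero_or_le_of_bumpOf_eq_zero {a : B} (ha : 0 ≤ a) {δ : ℝ}
    (h : bumpOf δ a = 0) {x : ℝ} (hx : x ∈ spectrum ℝ a) : x = 0 ∨ δ ≤ x := by
  have hs : IsSelfAdjoint a := .of_nonneg ha
  have h0 : cfc (bump δ) a = cfc (fun _ : ℝ => 0) a := by rw [← bumpOf, h, cfc_const_zero]
  have hb : bump δ x = 0 :=
    eqOn_of_cfc_eq_cfc h0 (hf := continuousOn_bump ha δ) (hg := continuousOn_const) (ha := hs) hx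
  have hx0 := spectrum_nonneg ha hx
  by_contra! hne
  have hpos : 0 < x := lt_of_le_of_ne hx0 (Ne.symm hne.1)
  have h1 : (1 + x)⁻¹ < 1 := inv_lt_one_of_one_lt₀ (by linarith)
  have : 0 < bump δ x := lt_max_of_lt_right (lt_min (by linarith) (by linarith))
  linarith

/-- A positive element whose spectrum omits an interval `(0, δ)` is Cuntz equivalent to a
projection. -/
theorem exists_projection_of_gap {a : B} (ha : 0 ≤ a) {δ : ℝ} (hδ : 0 < δ)
    (h : ∀ x ∈ spectrum ℝ a, x = 0 ∨ δ ≤ x) :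
    ∃ p v w : B, IsStarProjection p ∧ v * p * star v = a ∧ w * a * star w = p := by
  have hs : IsSelfAdjoint a := .of_nonneg ha
  -- On a spectrum inside `{0} ∪ [δ, ∞)` this continuous function takes only the values `0` and `1`.
  -- The implementing elements are `a^{1/2}` and `max(a, δ)^{-1/2}`.
  set f : ℝ → ℝ := fun x => x / max x δ with hf
  have hmax (x : ℝ) : 0 < max x δ := lt_max_of_lt_right hδ
  have hfc : Continuous f := continuous_id.div (by fun_prop) fun x => (hmax x).ne'
  have hf01 (x : ℝ) (hx : x ∈ spectrum ℝ a) : f x = 0 ∧ x = 0 ∨ f x = 1 := by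
    rcases h x hx with h | h
    · exact Or.inl ⟨by simp [hf, h], h⟩
    · refine Or.inr ?_
      simp only [hf, max_eq_left h]
      exact div_self (hδ.trans_le h).ne'
  have hgc : Continuous fun x : ℝ => (√(max x δ))⁻¹ :=
    Continuous.inv₀ (by fun_prop) fun x => (Real.sqrt_pos.2 (hmax x)).ne'
  refine ⟨cfc f a, cfc (fun x : ℝ => √x) a, cfc (fun x : ℝ => (√(max x δ))⁻¹) a,
    ⟨?_, cfc_predicate f a⟩, ?_, ?_⟩
  · rw [IsIdempotentElem, ← cfc_mul _ _ a hfc.continuousOn hfc.continuousOn]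
    refine cfc_congr fun x hx => ?_
    rcases hf01 x hx with h | h
    · simp [h.1]
    · simp [h]
  · have e : IsSelfAdjoint (cfc (fun x : ℝ => √x) a) := cfc_predicate _ a
    rw [e.star_eq, ← cfc_mul _ _ a (by fun_prop) hfc.continuousOn,
      ← cfc_mul _ _ a (Continuous.continuousOn (by fun_prop)) (by fun_prop)]
    conv_rhs => rw [← cfc_id' ℝ a]
    refine cfc_congr fun x hx => ?_
    rcases hf01 x hx with h | h
    · simp [h.2]
    · simp [h, Real.mul_self_sqrt (spectrum_nonneg ha hx)]
  · have e : IsSelfAdjoint (cfc (fun x : ℝ => (√(max x δ))⁻¹) a) := cfc_predicate _ a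
    conv_lhs => rw [e.star_eq]; enter [1, 2]; rw [← cfc_id' ℝ a]
    rw [← cfc_mul _ _ a hgc.continuousOn (by fun_prop),
      ← cfc_mul _ _ a (Continuous.continuousOn (by fun_prop)) hgc.continuousOn]
    refine cfc_congr fun x hx => ?_
    have h1 := Real.mul_self_sqrt (hmax x).le
    have h2 := (Real.sqrt_pos.2 (hmax x)).ne'
    simp only [hf]
    rw [← h1]
    simp only [Real.sqrt_mul_self (Real.sqrt_nonneg _)]
    field_simp

end Gap

/-! ### Faithfulness of traces; summands of projections -/

section Faithful

variable {A : Type u} [CStarAlgebra A] [PartialOrder A] [StarOrderedRing A]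

theorem re_apply_nonneg (τ : T A) {x : A} (hx : 0 ≤ x) : 0 ≤ (τ.1 x).re :=
  (Complex.nonneg_iff.1 (τ.2.1 _ hx)).1

theorem re_tracial_mono (τ : T A) {x y : A} (h : x ≤ y) : (τ.1 x).re ≤ (τ.1 y).re := by
  have := re_apply_nonneg τ (sub_nonneg.2 h)
  rw [map_sub, Complex.sub_re] at this
  linarith

theorem re_tracial_smul (τ : T A) (r : ℝ) (x : A) : (τ.1 (r • x)).re = r * (τ.1 x).re := by
  rw [← Complex.coe_smul, map_smul, smul_eq_mul, Complex.re_ofReal_mul]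

/-- Tracial states of a simple C⋆-algebra are faithful. -/
theorem eq_zero_of_re_star_mul_self_eq_zero (hsimple : IsSimpleCStar A) (τ : T A) {x : A}
    (hx : (τ.1 (star x * x)).re = 0) : x = 0 := by
  have hleft (a x : A) (hx : (τ.1 (star x * x)).re = 0) :
      (τ.1 (star (a * x) * (a * x))).re = 0 := by
    refine le_antisymm ?_ (re_apply_star_mul_self_nonneg τ _)
    have h : star (a * x) * (a * x) ≤ ‖star a * a‖ • (star x * x) := by
      have h := CStarAlgebra.star_left_conjugate_le_norm_smul (a := x) (b := star a * a)
        (.star_mul_self a)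
      simpa only [star_mul, mul_assoc] using h
    have h' := re_tracial_mono τ h
    rwa [re_tracial_smul, hx, mul_zero] at h'
  have hstar (x : A) : (τ.1 (star (star x) * star x)).re = (τ.1 (star x * x)).re := by
    rw [star_star, τ.2.2.2]
  -- The kernel of the seminorm of `τ` is a left ideal; traciality makes it self-adjoint, hence
  -- two-sided. It is closed and does not contain `1`.
  let I : TwoSidedIdeal A := TwoSidedIdeal.mk' {x : A | (τ.1 (star x * x)).re = 0}
    (by simp)
    (by
      intro x y (hx : _ = _) (hy : _ = _)
      refine le_antisymm ?_ (re_apply_star_mul_self_nonneg τ _)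
      have h := re_apply_star_mul_self_nonneg τ (x - y)
      have e : star (x + y) * (x + y) =
          (2 : ℝ) • (star x * x) + (2 : ℝ) • (star y * y) - star (x - y) * (x - y) := by
        simp only [star_add, star_sub, mul_add, add_mul, mul_sub, sub_mul, two_smul]
        abel
      rw [e, map_sub, map_add, Complex.sub_re, Complex.add_re, re_tracial_smul, re_tracial_smul,
        hx, hy]
      linarith)
    (by
      intro x (hx : _ = _)
      simpa using hx)
    (by
      intro x y (hy : _ = _)
      exact hleft x y hy)
    (by
      intro x y (hx : _ = _)
      have h := hleft (star y) (star x) (by rw [hstar]; exact hx)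
      rw [← star_mul, hstar] at h
      exact h)
  have hmem (y : A) : y ∈ I ↔ (τ.1 (star y * y)).re = 0 := TwoSidedIdeal.mem_mk' ..
  have hclosed : IsClosed (I : Set A) := by
    have e : (I : Set A) = {y : A | (τ.1 (star y * y)).re = 0} := Set.ext hmem
    rw [e]
    refine isClosed_eq ?_ continuous_const
    exact Complex.continuous_re.comp ((map_continuous τ.1).comp (by fun_prop))
  rcases hsimple.2 I hclosed with h | h
  · have := (hmem x).2 hx
    rw [h] at this
    simpa using this
  · have h1 : (1 : A) ∈ I := by rw [h]; trivial
    rw [hmem, star_one, mul_one, τ.2.2.1] at h1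
    simp at h1

theorem eq_zero_of_mtr_eq_zero (hsimple : IsSimpleCStar A) (τ : T A) {n : ℕ} {a : MatC n n A}
    (ha : 0 ≤ a) (h : mtr τ a = 0) : a = 0 := by
  obtain ⟨y, rfl⟩ := exists_star_mul_self_of_nonneg (h := CStarMatrix.instStarOrderedRing) ha
  have hnn (i k : Fin n) : 0 ≤ (τ.1 (star (y k i) * y k i)).re :=
    re_apply_star_mul_self_nonneg τ _
  rw [mtr_star_mul_self, Finset.sum_eq_zero_iff_of_nonneg fun i _ =>
    Finset.sum_nonneg fun k _ => hnn i k] at h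
  have hy : y = 0 := by
    ext k i
    refine eq_zero_of_re_star_mul_self_eq_zero hsimple τ ?_
    exact (Finset.sum_eq_zero_iff_of_nonneg fun k _ => hnn i k).1 (h i (Finset.mem_univ i)) k
      (Finset.mem_univ k)
  rw [hy, mul_zero]

/-- No rank is lost by truncation, so `τ` vanishes on the bump supported over `(0, δ)`. Faithfulness
makes the bump zero, which is a spectral gap. -/
theorem exists_projection_of_rank_le_trunc (hsimple : IsSimpleCStar A) (τ : T A) (a : PosMat A)
    {δ : ℝ} (hδ : 0 < δ) (h : rank τ a.mat ≤ rank τ (trunc δ a.mat)) :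
    ∃ q : ProjMat A, W.mk a = W.mk q.toPosMat := by
  have h1 := rankOf_trunc_add_le (re_mtrL_nonneg τ) a.nonneg hδ.le
  rw [re_mtrL] at h1
  have hb : 0 ≤ bumpOf δ a.mat := bumpOf_nonneg δ a.mat
  have h2 : mtr τ (bumpOf δ a.mat) = 0 := by
    refine le_antisymm ?_ (mtr_nonneg τ hb)
    unfold rank at h
    linarith
  obtain ⟨p, v, w, hp, hv, hw⟩ := exists_projection_of_gap a.nonneg hδ fun x hx =>
    eq_zero_or_le_of_bumpOf_eq_zero a.nonneg (eq_zero_of_mtr_eq_zero hsimple τ hb h2) hx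
  refine ⟨⟨a.size, p, hp⟩, le_antisymm ?_ ?_⟩
  · rw [W.mk_le_mk, cuntzLE_iff_mem_closure]
    exact subset_closure ⟨v, hv⟩
  · rw [W.mk_le_mk, cuntzLE_iff_mem_closure]
    exact subset_closure ⟨w, hw⟩

theorem rank_le_rank_smul (τ : T A) {n : ℕ} {a : MatC n n A} (ha : 0 ≤ a) {r : ℝ} (hr : 0 < r) :
    rank τ a ≤ rank τ (r • a) := by
  refine rank_le_of_forall_cut τ fun c hc => ?_
  have e : cut (c / r) (r • a) = cut c a := by
    refine (cut_smul ha (by positivity) hr.le).trans ?_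
    rw [div_mul_cancel₀ _ hr.ne']
  rw [← e]
  exact mtr_cut_le_rank τ (smul_nonneg hr.le ha) (by positivity)

/-- A projection has rank at most that of any positive element close to it. -/
theorem rank_projection_le_of_norm_sub_lt (τ : T A) {n : ℕ} {p x : MatC n n A}
    (hp : IsStarProjection p) (hx : 0 ≤ x) (h : ‖x - p‖ < 1 / 2) : rank τ p ≤ rank τ x := by
  have hs : IsSelfAdjoint (p - x) := hp.isSelfAdjoint.sub (.of_nonneg hx)
  have h1 : p - x ≤ (1 / 2 : ℝ) • 1 :=
    le_smul_one_of_norm_le hs ((norm_sub_rev _ _).trans_le h.le)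
  have hpp : p * p = p := hp.isIdempotentElem.eq
  have hps : star p = p := hp.isSelfAdjoint.star_eq
  -- Compressing `p - x ≤ 1/2` by `p` gives `p - p x p ≤ p / 2`.
  have h2 : (1 / 2 : ℝ) • p ≤ p * x * star p := by
    have h' := star_right_conjugate_le_conjugate h1 p
    rw [mul_sub, sub_mul, hpp, mul_smul_comm, mul_one, smul_mul_assoc, hps, hpp] at h'
    have e : p = (1 / 2 : ℝ) • p + (1 / 2 : ℝ) • p := by
      rw [← add_smul]; norm_num
    rw [hps]
    rw [sub_le_iff_le_add] at h'
    conv_lhs at h' => rw [e]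
    exact le_of_add_le_add_left h'
  calc rank τ p ≤ rank τ ((1 / 2 : ℝ) • p) := rank_le_rank_smul τ hp.nonneg (by norm_num)
    _ ≤ rank τ (p * x * star p) := rank_mono τ (smul_nonneg (by norm_num) hp.nonneg) h2
    _ ≤ rank τ x := rank_conj_le τ p hx

/-- In a simple C⋆-algebra with a tracial state, a summand of a class of a projection in the Cuntz
semigroup is the class of a projection. -/
theorem exists_projection_of_add_eq (hsimple : IsSimpleCStar A) (τ : T A) {a b : PosMat A}
    {p : ProjMat A} (h : W.mk a + W.mk b = W.mk p.toPosMat) :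
    ∃ q : ProjMat A, W.mk a = W.mk q.toPosMat := by
  rw [W.mk_add_mk] at h
  have hle : CuntzLE (dsum a.mat b.mat) p.mat := W.mk_le_mk.1 h.le
  have hge : CuntzLE p.mat (dsum a.mat b.mat) := W.mk_le_mk.1 h.ge
  obtain ⟨v, hv⟩ := hge
  obtain ⟨k, hk⟩ := (hv.eventually_lt_const (show (0 : ℝ) < 1 / 2 by norm_num)).exists
  have hcont : Continuous fun x : MatC a.size a.size A =>
      ‖v k * dsum x b.mat * (v k).conjTranspose - p.mat‖ := by
    refine Continuous.norm (Continuous.sub (continuous_mat_mul.comp ((continuous_mat_mul.comp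
      (continuous_const.prodMk ?_)).prodMk continuous_const)) continuous_const)
    exact continuous_dsum.comp (continuous_id.prodMk continuous_const)
  -- Being within `1/2` of `p` is an open condition on the first summand, so it survives the
  -- truncation of `a` at `ε / 2`. This gives rank of `p` at most rank of the truncation plus rank
  -- of `b`; since rank of `a` plus rank of `b` is at most rank of `p`, the rank of `b` cancels.
  obtain ⟨ε, hε, hball⟩ := Metric.mem_nhds_iff.1 (hcont.continuousAt.eventually_lt_const hk)
  have hδ : 0 < ε / 2 := by positivity
  refine exists_projection_of_rank_le_trunc hsimple τ a hδ ?_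
  have htr := trunc_nonneg (ε / 2) a.mat
  have hclose : ‖v k * dsum (trunc (ε / 2) a.mat) b.mat * (v k).conjTranspose - p.mat‖ < 1 / 2 := by
    refine hball ?_
    rw [Metric.mem_ball, dist_eq_norm]
    exact (norm_trunc_sub_le a.nonneg hδ.le).trans_lt (by linarith)
  have hd := dsum_nonneg htr b.nonneg
  have h1 := rank_projection_le_of_norm_sub_lt τ p.isProj (conj_nonneg (v k) hd) hclose
  have h2 := rank_conj_le τ (v k) hd
  have h3 := rank_le_of_cuntzLE τ (dsum_nonneg a.nonneg b.nonneg) p.isProj.nonneg hle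
  rw [rank_dsum τ htr b.nonneg] at h2
  rw [rank_dsum τ a.nonneg b.nonneg] at h3
  linarith

end Faithful

/-! ### Commuting Radon-Nikodym derivatives of traces -/

section GNS

open PositiveLinearMap UniformSpace

open scoped InnerProductSpace

variable {A : Type u} [CStarAlgebra A] [PartialOrder A] [StarOrderedRing A]

/-- The vector of the GNS space of `f` given by an element of the algebra. -/
def gnsVec (f : A →ₚ[ℂ] ℂ) (a : A) : f.GNS := ((f.toPreGNS a : f.PreGNS) : f.GNS)

variable {f g : A →ₚ[ℂ] ℂ}

theorem inner_gnsVec (a b : A) : ⟪gnsVec f a, gnsVec f b⟫_ℂ = f (star a * b) := by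
  rw [gnsVec, gnsVec, Completion.inner_coe, preGNS_inner_def]
  simp

theorem ext_gnsVec {ξ η : f.GNS} (h : ∀ a : A, ⟪gnsVec f a, ξ⟫_ℂ = ⟪gnsVec f a, η⟫_ℂ) :
    ξ = η := by
  refine ext_inner_left ℂ fun v => ?_
  induction v using Completion.induction_on with
  | hp => exact isClosed_eq (by fun_prop) (by fun_prop)
  | ih v => exact h (f.ofPreGNS v)

theorem ext_gnsVec_op {S R : f.GNS →L[ℂ] f.GNS} (h : ∀ a : A, S (gnsVec f a) = R (gnsVec f a)) :
    S = R := by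
  ext v
  induction v using Completion.induction_on with
  | hp => exact isClosed_eq (by fun_prop) (by fun_prop)
  | ih v => exact h (f.ofPreGNS v)

/-- The conjugate linear isometry of the GNS space induced by the involution. -/
def gnsStar (f : A →ₚ[ℂ] ℂ) : f.GNS → f.GNS :=
  Completion.map fun x : f.PreGNS => f.toPreGNS (star (f.ofPreGNS x))

theorem isometry_star_preGNS (hf : ∀ a b : A, f (a * b) = f (b * a)) :
    Isometry fun x : f.PreGNS => f.toPreGNS (star (f.ofPreGNS x)) := by
  refine Isometry.of_dist_eq fun x y => ?_
  rw [dist_eq_norm, dist_eq_norm, ← map_sub, ← star_sub, ← map_sub, preGNS_norm_def,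
    preGNS_norm_def, ofPreGNS_toPreGNS, star_star, hf]

theorem continuous_gnsStar : Continuous (gnsStar f) := Completion.continuous_map

theorem gnsStar_gnsVec (hf : ∀ a b : A, f (a * b) = f (b * a)) (a : A) :
    gnsStar f (gnsVec f a) = gnsVec f (star a) :=
  Completion.map_coe (isometry_star_preGNS hf).uniformContinuous _

theorem inner_gnsStar (hf : ∀ a b : A, f (a * b) = f (b * a)) (ξ η : f.GNS) :
    ⟪gnsStar f ξ, gnsStar f η⟫_ℂ = ⟪η, ξ⟫_ℂ := by
  have hc := continuous_gnsStar (f := f)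
  induction ξ, η using Completion.induction_on₂ with
  | hp => exact isClosed_eq (by fun_prop) (by fun_prop)
  | ih x y =>
    have h : ∀ a b : A, ⟪gnsStar f (gnsVec f a), gnsStar f (gnsVec f b)⟫_ℂ =
        ⟪gnsVec f b, gnsVec f a⟫_ℂ := fun a b => by
      rw [gnsStar_gnsVec hf, gnsStar_gnsVec hf, inner_gnsVec, inner_gnsVec, star_star, hf]
    exact h (f.ofPreGNS x) (f.ofPreGNS y)

/-- A positive functional dominated by `f` is given by a positive operator on the GNS space. -/
theorem exists_gnsOp (hle : ∀ a : A, 0 ≤ a → g a ≤ f a) :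
    ∃ h : f.GNS →L[ℂ] f.GNS, 0 ≤ h ∧
      ∀ a b : A, ⟪gnsVec f a, h (gnsVec f b)⟫_ℂ = g (star a * b) := by
  -- As `g ≤ f`, the identity of `A` is a contraction from the seminorm of `f` to that of `g`. Its
  -- extension `S` to the completions gives the operator `S⋆ S`.
  let S₀ : f.PreGNS →ₗ[ℂ] g.PreGNS := g.toPreGNS.toLinearMap ∘ₗ f.ofPreGNS.toLinearMap
  let S : f.PreGNS →L[ℂ] g.PreGNS := S₀.mkContinuous 1 fun x => by
    rw [one_mul, preGNS_norm_def, preGNS_norm_def]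
    exact Real.sqrt_le_sqrt (Complex.le_def.1 (hle _ (star_mul_self_nonneg _))).1
  have hS (a : A) : S.completion (gnsVec f a) = gnsVec g a :=
    ContinuousLinearMap.completion_apply_coe S (f.toPreGNS a)
  refine ⟨S.completion.adjoint ∘L S.completion, ?_, fun a b => ?_⟩
  · rw [ContinuousLinearMap.nonneg_iff_isPositive]
    exact ContinuousLinearMap.isPositive_adjoint_comp_self _
  · rw [ContinuousLinearMap.comp_apply, ContinuousLinearMap.adjoint_inner_right, hS, hS,
      inner_gnsVec]

theorem gnsStarAlgHom_gnsVec (a b : A) : f.gnsStarAlgHom a (gnsVec f b) = gnsVec f (a * b) := by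
  exact gnsNonUnitalStarAlgHom_apply_coe f

theorem inner_gnsStarAlgHom (a : A) (ξ η : f.GNS) :
    ⟪ξ, f.gnsStarAlgHom a η⟫_ℂ = ⟪f.gnsStarAlgHom (star a) ξ, η⟫_ℂ := by
  rw [map_star, ContinuousLinearMap.star_eq_adjoint, ContinuousLinearMap.adjoint_inner_left]

/-- The form of `h` depends only on `star a * b`, so `h` lies in the commutant of the left
representation. -/
theorem gnsOp_gnsVec {h : f.GNS →L[ℂ] f.GNS}
    (hh : ∀ a b : A, ⟪gnsVec f a, h (gnsVec f b)⟫_ℂ = g (star a * b)) (a b : A) :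
    h (gnsVec f (a * b)) = f.gnsStarAlgHom a (h (gnsVec f b)) := by
  refine ext_gnsVec fun c => ?_
  rw [hh, inner_gnsStarAlgHom, gnsStarAlgHom_gnsVec, hh, star_mul, star_star, mul_assoc]

/-- Traciality of both functionals makes `h` commute with the antilinear isometry induced by the
involution. -/
theorem gnsStar_gnsOp (hf : ∀ a b : A, f (a * b) = f (b * a))
    (hg : ∀ a b : A, g (a * b) = g (b * a)) {h : f.GNS →L[ℂ] f.GNS}
    (hh : ∀ a b : A, ⟪gnsVec f a, h (gnsVec f b)⟫_ℂ = g (star a * b)) (a : A) :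
    gnsStar f (h (gnsVec f a)) = h (gnsVec f (star a)) := by
  refine ext_gnsVec fun c => ?_
  have e : gnsVec f c = gnsStar f (gnsVec f (star c)) := by rw [gnsStar_gnsVec hf, star_star]
  conv_lhs => rw [e]
  rw [inner_gnsStar hf, ← inner_conj_symm, hh, hh, star_star, ← Complex.star_def, ← map_star,
    star_mul, hg]

theorem inner_nonneg_op {h : f.GNS →L[ℂ] f.GNS} (hh : 0 ≤ h) (ξ η : f.GNS) :
    ⟪h ξ, η⟫_ℂ = ⟪ξ, h η⟫_ℂ := by
  have hs : h.adjoint = h := (IsSelfAdjoint.of_nonneg hh).star_eq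
  conv_rhs => rw [← hs]
  rw [ContinuousLinearMap.adjoint_inner_right]

section Swap

variable {g₁ g₂ : A →ₚ[ℂ] ℂ} {h k : f.GNS →L[ℂ] f.GNS}

theorem inner_gnsOp_gnsOp
    (hh : ∀ a b : A, ⟪gnsVec f a, h (gnsVec f b)⟫_ℂ = g₁ (star a * b))
    (hk : ∀ a b : A, ⟪gnsVec f a, k (gnsVec f b)⟫_ℂ = g₂ (star a * b)) (a b : A) :
    ⟪h (gnsVec f a), k (gnsVec f b)⟫_ℂ = ⟪h (gnsVec f 1), k (gnsVec f (star a * b))⟫_ℂ := by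
  rw [gnsOp_gnsVec hk, inner_gnsStarAlgHom, star_star, ← gnsOp_gnsVec hh, mul_one]

/-- The antilinear isometry commutes with `h` and `k` and reverses inner products. Applied to `⟪h
a⋆, k b⟫` it exchanges the two operators. The case `a = 1` gives commutation of `h` and `k`; the
general case then gives traciality of their product. -/
theorem inner_gnsOp_swap (hf : ∀ a b : A, f (a * b) = f (b * a))
    (hg₁ : ∀ a b : A, g₁ (a * b) = g₁ (b * a)) (hg₂ : ∀ a b : A, g₂ (a * b) = g₂ (b * a))
    (hh : ∀ a b : A, ⟪gnsVec f a, h (gnsVec f b)⟫_ℂ = g₁ (star a * b))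
    (hk : ∀ a b : A, ⟪gnsVec f a, k (gnsVec f b)⟫_ℂ = g₂ (star a * b)) (a b : A) :
    ⟪h (gnsVec f 1), k (gnsVec f (a * b))⟫_ℂ = ⟪k (gnsVec f 1), h (gnsVec f (b * a))⟫_ℂ := by
  have h1 := inner_gnsOp_gnsOp hh hk (star a) b
  have h2 := inner_gnsOp_gnsOp hk hh (star b) a
  rw [star_star] at h1 h2
  rw [← h1, ← h2, ← inner_gnsStar hf, gnsStar_gnsOp hf hg₁ hh, gnsStar_gnsOp hf hg₂ hk, star_star]

/-- The operators that represent tracial functionals commute. -/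
theorem commute_gnsOp (hf : ∀ a b : A, f (a * b) = f (b * a))
    (hg₁ : ∀ a b : A, g₁ (a * b) = g₁ (b * a)) (hg₂ : ∀ a b : A, g₂ (a * b) = g₂ (b * a))
    (hh : ∀ a b : A, ⟪gnsVec f a, h (gnsVec f b)⟫_ℂ = g₁ (star a * b))
    (hk : ∀ a b : A, ⟪gnsVec f a, k (gnsVec f b)⟫_ℂ = g₂ (star a * b)) (hh0 : 0 ≤ h)
    (hk0 : 0 ≤ k) : Commute h k := by
  refine ext_gnsVec_op fun b => ext_gnsVec fun a => ?_
  change ⟪gnsVec f a, h (k (gnsVec f b))⟫_ℂ = ⟪gnsVec f a, k (h (gnsVec f b))⟫_ℂ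
  rw [← inner_nonneg_op hh0, ← inner_nonneg_op hk0 _ (h _), inner_gnsOp_gnsOp hh hk,
    inner_gnsOp_gnsOp hk hh]
  simpa using inner_gnsOp_swap hf hg₁ hg₂ hh hk 1 (star a * b)

/-- The product of two tracial functionals dominated by `f`. -/
theorem exists_tracial_product (hf : ∀ a b : A, f (a * b) = f (b * a))
    (hg₁ : ∀ a b : A, g₁ (a * b) = g₁ (b * a)) (hg₂ : ∀ a b : A, g₂ (a * b) = g₂ (b * a))
    (hh : ∀ a b : A, ⟪gnsVec f a, h (gnsVec f b)⟫_ℂ = g₁ (star a * b))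
    (hk : ∀ a b : A, ⟪gnsVec f a, k (gnsVec f b)⟫_ℂ = g₂ (star a * b)) (hh0 : 0 ≤ h)
    (hk0 : 0 ≤ k) : ∃ r : A →ₚ[ℂ] ℂ, (∀ a b : A, r (a * b) = r (b * a)) ∧
      ∀ a : A, r a = ⟪gnsVec f 1, h (k (gnsVec f a))⟫_ℂ := by
  -- Commuting positive operators have a positive product, which is why commutation is needed for
  -- positivity of the new functional.
  have hpos : 0 ≤ h * k :=
    Commute.mul_nonneg hh0 hk0 (commute_gnsOp hf hg₁ hg₂ hh hk hh0 hk0)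
  have hsw := inner_gnsOp_swap hf hg₁ hg₂ hh hk
  let r : A →ₗ[ℂ] ℂ :=
    { toFun := fun a => ⟪h (gnsVec f 1), k (gnsVec f a)⟫_ℂ
      map_add' := fun a b => by
        have : gnsVec f (a + b) = gnsVec f a + gnsVec f b := by
          simp [gnsVec, Completion.coe_add]
        rw [this, map_add, inner_add_right]
      map_smul' := fun c a => by
        have : gnsVec f (c • a) = c • gnsVec f a := by
          simp [gnsVec, Completion.coe_smul]
        rw [this, map_smul, inner_smul_right]
        rfl }
  have hr (a : A) : r a = ⟪h (gnsVec f 1), k (gnsVec f a)⟫_ℂ := rfl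
  have hpos' (a : A) (ha : 0 ≤ a) : 0 ≤ r a := by
    obtain ⟨b, rfl⟩ := exists_star_mul_self_of_nonneg ha
    rw [hr, ← inner_gnsOp_gnsOp hh hk, inner_nonneg_op hh0]
    exact ((ContinuousLinearMap.nonneg_iff_isPositive _).1 hpos).inner_nonneg_right _
  refine ⟨.mk₀ r hpos', fun a b => ?_, fun a => ?_⟩
  · have h2 := hsw 1 (b * a)
    rw [one_mul, mul_one] at h2
    exact (hsw a b).trans h2.symm
  · exact inner_nonneg_op hh0 _ _

end Swap

end GNS

/-! ### The simplex property of the cone of traces -/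

section Refinement

open PositiveLinearMap UniformSpace

open scoped InnerProductSpace

variable {A : Type u} [CStarAlgebra A] [PartialOrder A] [StarOrderedRing A]

variable (A) in
/-- The cone of positive tracial functionals. -/
def posTraces : AddSubmonoid (WeakDual ℂ A) where
  carrier := {θ | (∀ a : A, 0 ≤ a → 0 ≤ θ a) ∧ ∀ a b : A, θ (a * b) = θ (b * a)}
  zero_mem' := ⟨fun _ _ => le_rfl, fun _ _ => rfl⟩
  add_mem' hθ hψ := ⟨fun a ha => add_nonneg (hθ.1 a ha) (hψ.1 a ha), fun a b =>
    congrArg₂ (· + ·) (hθ.2 a b) (hψ.2 a b)⟩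

/-- A positive tracial functional, as a positive linear map. -/
def toPositive (θ : posTraces A) : A →ₚ[ℂ] ℂ :=
  .mk₀ (θ.1 : A →L[ℂ] ℂ).toLinearMap θ.2.1

theorem toPositive_apply (θ : posTraces A) (a : A) : toPositive θ a = θ.1 a := rfl

/-- A positive tracial linear map, as an element of the cone of positive tracial functionals. -/
def ofPositive (g : A →ₚ[ℂ] ℂ) (hg : ∀ a b : A, g (a * b) = g (b * a)) : posTraces A :=
  ⟨StrongDual.toWeakDual ⟨g.toLinearMap, map_continuous g⟩, fun _ ha => g.map_nonneg ha, hg⟩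

theorem toPositive_tracial (θ : posTraces A) (a b : A) :
    toPositive θ (a * b) = toPositive θ (b * a) := θ.2.2 a b

/-- The refinement property of an additive commutative monoid. -/
def HasRefinement (M : Type*) [AddCommMonoid M] : Prop :=
  ∀ x₁ x₂ y₁ y₂ : M, x₁ + x₂ = y₁ + y₂ →
    ∃ z₁₁ z₁₂ z₂₁ z₂₂ : M, z₁₁ + z₁₂ = x₁ ∧ z₂₁ + z₂₂ = x₂ ∧ z₁₁ + z₂₁ = y₁ ∧ z₁₂ + z₂₂ = y₂

/-- Relative to the common sum `f`, the four traces have densities `h₁, h₂` and `k₁, k₂`, with `h₁ +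
h₂ = 1 = k₁ + k₂`. The products `hᵢ kⱼ` are the densities of the refinement, as for measures. -/
theorem hasRefinement_posTraces : HasRefinement (posTraces A) := by
  intro θ₁ θ₂ ψ₁ ψ₂ hsum
  have hsum' (a : A) : θ₁.1 a + θ₂.1 a = ψ₁.1 a + ψ₂.1 a :=
    congrArg (fun θ : posTraces A => θ.1 a) hsum
  set f := toPositive (θ₁ + θ₂) with hf
  have hf_apply (a : A) : f a = θ₁.1 a + θ₂.1 a := rfl
  have hft := toPositive_tracial (θ₁ + θ₂)
  obtain ⟨h₁, hh₁0, hh₁⟩ := exists_gnsOp (f := f) (g := toPositive θ₁) fun a ha => by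
    rw [hf_apply, toPositive_apply]
    exact le_add_of_nonneg_right (θ₂.2.1 a ha)
  obtain ⟨h₂, hh₂0, hh₂⟩ := exists_gnsOp (f := f) (g := toPositive θ₂) fun a ha => by
    rw [hf_apply, toPositive_apply]
    exact le_add_of_nonneg_left (θ₁.2.1 a ha)
  obtain ⟨k₁, hk₁0, hk₁⟩ := exists_gnsOp (f := f) (g := toPositive ψ₁) fun a ha => by
    rw [hf_apply, hsum', toPositive_apply]
    exact le_add_of_nonneg_right (ψ₂.2.1 a ha)
  obtain ⟨k₂, hk₂0, hk₂⟩ := exists_gnsOp (f := f) (g := toPositive ψ₂) fun a ha => by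
    rw [hf_apply, hsum', toPositive_apply]
    exact le_add_of_nonneg_left (ψ₁.2.1 a ha)
  have hh : h₁ + h₂ = 1 := by
    refine ext_gnsVec_op fun b => ext_gnsVec fun a => ?_
    rw [_root_.add_apply, inner_add_right, hh₁, hh₂, one_apply_eq_self,
      inner_gnsVec]
    rfl
  have hk : k₁ + k₂ = 1 := by
    refine ext_gnsVec_op fun b => ext_gnsVec fun a => ?_
    rw [_root_.add_apply, inner_add_right, hk₁, hk₂, one_apply_eq_self,
      inner_gnsVec, hf_apply, hsum']
    rfl
  have key (θ ψ : posTraces A) (h k : f.GNS →L[ℂ] f.GNS) (hh0 : 0 ≤ h) (hk0 : 0 ≤ k)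
      (hh : ∀ a b : A, ⟪gnsVec f a, h (gnsVec f b)⟫_ℂ = toPositive θ (star a * b))
      (hk : ∀ a b : A, ⟪gnsVec f a, k (gnsVec f b)⟫_ℂ = toPositive ψ (star a * b)) :
      ∃ r : posTraces A, ∀ a : A, r.1 a = ⟪gnsVec f 1, h (k (gnsVec f a))⟫_ℂ := by
    obtain ⟨r, hrt, hr⟩ := exists_tracial_product hft (toPositive_tracial θ)
      (toPositive_tracial ψ) hh hk hh0 hk0
    exact ⟨ofPositive r hrt, hr⟩
  obtain ⟨r₁₁, e₁₁⟩ := key _ _ h₁ k₁ hh₁0 hk₁0 hh₁ hk₁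
  obtain ⟨r₁₂, e₁₂⟩ := key _ _ h₁ k₂ hh₁0 hk₂0 hh₁ hk₂
  obtain ⟨r₂₁, e₂₁⟩ := key _ _ h₂ k₁ hh₂0 hk₁0 hh₂ hk₁
  obtain ⟨r₂₂, e₂₂⟩ := key _ _ h₂ k₂ hh₂0 hk₂0 hh₂ hk₂
  have hh' (ξ : f.GNS) : h₁ ξ + h₂ ξ = ξ := by rw [← _root_.add_apply, hh]; rfl
  have hk' (ξ : f.GNS) : k₁ ξ + k₂ ξ = ξ := by rw [← _root_.add_apply, hk]; rfl
  have hθ (θ : posTraces A) (h : f.GNS →L[ℂ] f.GNS)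
      (hh : ∀ a b : A, ⟪gnsVec f a, h (gnsVec f b)⟫_ℂ = toPositive θ (star a * b)) (a : A) :
      ⟪gnsVec f 1, h (gnsVec f a)⟫_ℂ = θ.1 a := by
    rw [hh, star_one, one_mul]
    rfl
  have hadd (r s θ : posTraces A) (h : ∀ a : A, r.1 a + s.1 a = θ.1 a) : r + s = θ :=
    Subtype.ext (DFunLike.ext _ _ h)
  refine ⟨r₁₁, r₁₂, r₂₁, r₂₂, hadd _ _ _ fun a => ?_, hadd _ _ _ fun a => ?_,
    hadd _ _ _ fun a => ?_, hadd _ _ _ fun a => ?_⟩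
  · rw [e₁₁, e₁₂, ← inner_add_right, ← map_add, hk', hθ _ _ hh₁]
  · rw [e₂₁, e₂₂, ← inner_add_right, ← map_add, hk', hθ _ _ hh₂]
  · rw [e₁₁, e₂₁, ← inner_add_right, hh', hθ _ _ hk₁]
  · rw [e₁₂, e₂₂, ← inner_add_right, hh', hθ _ _ hk₂]

end Refinement

/-! ### Infimal convolution on refinement monoids -/

section InfConvolution

variable {M : Type*} [AddCommMonoid M]

/-- The infimal convolution of two functions on a commutative monoid. -/
def infConv (a b : M → ℝ) (x : M) : ℝ := ⨅ p : {p : M × M // p.1 + p.2 = x}, a p.1.1 + b p.1.2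

variable {a b : M → ℝ}

/-- Nonnegativity of `a` and `b` bounds the family below, so the real infimum is not a default
value. -/
theorem infConv_le (ha : ∀ x, 0 ≤ a x) (hb : ∀ x, 0 ≤ b x) {x y z : M} (h : y + z = x) :
    infConv a b x ≤ a y + b z :=
  ciInf_le (f := fun p : {p : M × M // p.1 + p.2 = x} => a p.1.1 + b p.1.2)
    ⟨0, by rintro _ ⟨p, rfl⟩; exact add_nonneg (ha _) (hb _)⟩ ⟨(y, z), h⟩

theorem le_infConv {x : M} {c : ℝ} (h : ∀ y z, y + z = x → c ≤ a y + b z) :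
    c ≤ infConv a b x := by
  have : Nonempty {p : M × M // p.1 + p.2 = x} := ⟨⟨(x, 0), add_zero x⟩⟩
  exact le_ciInf fun p => h _ _ p.2

theorem infConv_nonneg (ha : ∀ x, 0 ≤ a x) (hb : ∀ x, 0 ≤ b x) (x : M) : 0 ≤ infConv a b x :=
  le_infConv fun y z _ => add_nonneg (ha y) (hb z)

/-- Adding decompositions of `x₁` and `x₂` gives subadditivity. Refinement splits a decomposition of
`x₁ + x₂` into decompositions of the summands, which gives the converse. -/
theorem infConv_add (hM : HasRefinement M) (ha : ∀ x, 0 ≤ a x) (hb : ∀ x, 0 ≤ b x)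
    (ha' : ∀ x y, a (x + y) = a x + a y) (hb' : ∀ x y, b (x + y) = b x + b y) (x₁ x₂ : M) :
    infConv a b (x₁ + x₂) = infConv a b x₁ + infConv a b x₂ := by
  refine le_antisymm ?_ (le_infConv fun y z h => ?_)
  · rw [← sub_le_iff_le_add]
    refine le_infConv fun y₁ z₁ h₁ => ?_
    rw [sub_le_comm]
    refine le_infConv fun y₂ z₂ h₂ => ?_
    have h := infConv_le ha hb (x := x₁ + x₂) (y := y₁ + y₂) (z := z₁ + z₂)
      (by rw [← h₁, ← h₂, add_add_add_comm])
    rw [ha', hb'] at h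
    linarith
  · obtain ⟨z₁₁, z₁₂, z₂₁, z₂₂, rfl, rfl, rfl, rfl⟩ := hM x₁ x₂ y z h.symm
    have h₁ := infConv_le ha hb (x := z₁₁ + z₁₂) rfl
    have h₂ := infConv_le ha hb (x := z₂₁ + z₂₂) rfl
    rw [ha', hb']
    linarith

end InfConvolution

/-! ### Homogeneous extension of functions from tracial states to the cone of traces -/

section Homogenization

variable {A : Type u} [CStarAlgebra A] [PartialOrder A] [StarOrderedRing A]

/-- The total mass `θ(1)` of a positive tracial functional. -/
def mass (θ : posTraces A) : ℝ := (θ.1 1).re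

theorem mass_nonneg (θ : posTraces A) : 0 ≤ mass θ :=
  (Complex.nonneg_iff.1 (θ.2.1 1 zero_le_one)).1

theorem coe_mass (θ : posTraces A) : (mass θ : ℂ) = θ.1 1 :=
  Complex.ext rfl (Complex.nonneg_iff.1 (θ.2.1 1 zero_le_one)).2

theorem mass_add (θ ψ : posTraces A) : mass (θ + ψ) = mass θ + mass ψ :=
  Complex.add_re _ _

/-- Cauchy-Schwarz against the cyclic vector `1`, with the bound of left multiplication by `a` on
the GNS space. -/
theorem norm_apply_le_mass (θ : posTraces A) (a : A) : ‖θ.1 a‖ ≤ mass θ * ‖a‖ := by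
  set f := toPositive θ with hf
  have h1 : ‖f (star 1 * a)‖ ≤ ‖f.toPreGNS 1‖ * ‖f.toPreGNS a‖ :=
    norm_inner_le_norm (𝕜 := ℂ) (f.toPreGNS 1) (f.toPreGNS a)
  have h2 : ‖f.toPreGNS 1‖ = √(mass θ) := by
    rw [PositiveLinearMap.preGNS_norm_def, PositiveLinearMap.ofPreGNS_toPreGNS, star_one, mul_one]
    rfl
  have h3 : ‖f.toPreGNS a‖ ≤ ‖a‖ * √(mass θ) := by
    have h := (f.leftMulMapPreGNS a).le_of_opNorm_le (LinearMap.mkContinuous_norm_le _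
      (norm_nonneg a) _) (f.toPreGNS 1)
    rw [h2] at h
    have e : f.leftMulMapPreGNS a (f.toPreGNS 1) = f.toPreGNS a := by
      rw [PositiveLinearMap.leftMulMapPreGNS_apply]
      simp
    rwa [e] at h
  rw [star_one, one_mul, h2] at h1
  calc ‖θ.1 a‖ ≤ √(mass θ) * ‖f.toPreGNS a‖ := h1
    _ ≤ √(mass θ) * (‖a‖ * √(mass θ)) := by gcongr
    _ = √(mass θ) * √(mass θ) * ‖a‖ := by ring
    _ = mass θ * ‖a‖ := by rw [Real.mul_self_sqrt (mass_nonneg θ)]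

theorem eq_zero_of_mass_eq_zero {θ : posTraces A} (h : mass θ = 0) : θ = 0 := by
  refine Subtype.ext (DFunLike.ext _ _ fun a => ?_)
  have := norm_apply_le_mass θ a
  rw [h, zero_mul] at this
  exact norm_le_zero_iff.1 this

theorem continuous_mass : Continuous (mass (A := A)) :=
  Complex.continuous_re.comp ((WeakDual.eval_continuous (1 : A)).comp continuous_subtype_val)

theorem isClosed_posTraces : IsClosed (posTraces A : Set (WeakDual ℂ A)) := by
  have e : (posTraces A : Set (WeakDual ℂ A)) =
      (⋂ (a : A) (_ : 0 ≤ a), {θ | 0 ≤ θ a}) ∩ ⋂ (a : A) (b : A), {θ | θ (a * b) = θ (b * a)} := by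
    ext θ
    simp [posTraces]
  rw [e]
  refine IsClosed.inter (isClosed_biInter fun a _ => ?_)
    (isClosed_iInter fun a => isClosed_iInter fun b => ?_)
  · exact isClosed_Ici.preimage (WeakDual.eval_continuous a)
  · exact isClosed_eq (WeakDual.eval_continuous _) (WeakDual.eval_continuous _)

theorem isCompact_mass_le_one : IsCompact {θ : posTraces A | mass θ ≤ 1} := by
  rw [Subtype.isCompact_iff]
  refine (WeakDual.isCompact_closedBall (𝕜 := ℂ) (0 : StrongDual ℂ A) 1).of_isClosed_subset ?_ ?_
  · have e : ((↑) : posTraces A → WeakDual ℂ A) '' {θ : posTraces A | mass θ ≤ 1} =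
        (posTraces A : Set (WeakDual ℂ A)) ∩ {θ | (θ 1).re ≤ 1} := by
      ext θ
      constructor
      · rintro ⟨θ, h, rfl⟩
        exact ⟨θ.2, h⟩
      · rintro ⟨h, h'⟩
        exact ⟨⟨θ, h⟩, h', rfl⟩
    rw [e]
    exact isClosed_posTraces.inter (isClosed_le
      (Complex.continuous_re.comp (WeakDual.eval_continuous (1 : A))) continuous_const)
  · rintro _ ⟨θ, h, rfl⟩
    simp only [Set.mem_preimage, Metric.mem_closedBall, dist_zero_right]
    refine ContinuousLinearMap.opNorm_le_bound _ zero_le_one fun a => ?_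
    exact (norm_apply_le_mass θ a).trans (mul_le_mul_of_nonneg_right h (norm_nonneg a))

/-- A nonnegative multiple of a positive tracial functional. -/
def scale (c : ℝ) (hc : 0 ≤ c) (θ : posTraces A) : posTraces A :=
  ⟨(c : ℂ) • θ.1, fun a ha => mul_nonneg (Complex.zero_le_real.2 hc) (θ.2.1 a ha),
    fun a b => congrArg ((c : ℂ) * ·) (θ.2.2 a b)⟩

theorem scale_val (c : ℝ) (hc : 0 ≤ c) (θ : posTraces A) : (scale c hc θ).1 = (c : ℂ) • θ.1 := rfl

theorem mass_scale (c : ℝ) (hc : 0 ≤ c) (θ : posTraces A) : mass (scale c hc θ) = c * mass θ :=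
  Complex.re_ofReal_mul _ _

theorem scale_add (c : ℝ) (hc : 0 ≤ c) (θ ψ : posTraces A) :
    scale c hc (θ + ψ) = scale c hc θ + scale c hc ψ :=
  Subtype.ext (smul_add (c : ℂ) θ.1 ψ.1)

theorem scale_inv_scale {c : ℝ} (hc : 0 < c) (θ : posTraces A) :
    scale c hc.le (scale c⁻¹ (inv_nonneg.2 hc.le) θ) = θ := by
  refine Subtype.ext ?_
  rw [scale_val, scale_val, smul_smul, ← Complex.ofReal_mul, mul_inv_cancel₀ hc.ne',
    Complex.ofReal_one, one_smul]

/-- A tracial state, as a positive tracial functional. -/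
def ofState (τ : T A) : posTraces A := ⟨τ.1, τ.2.1, τ.2.2.2⟩

theorem mass_ofState (τ : T A) : mass (ofState τ) = 1 := by
  have : mass (ofState τ) = (τ.1 1).re := rfl
  rw [this, τ.2.2.1, Complex.one_re]

variable [Nonempty (T A)]

/-- The tracial state proportional to a positive tracial functional. -/
def normalize (θ : posTraces A) : T A :=
  if h : 0 < mass θ then
    ⟨(scale (mass θ)⁻¹ (inv_nonneg.2 h.le) θ).1, (scale (mass θ)⁻¹ (inv_nonneg.2 h.le) θ).2.1, by
      rw [← coe_mass, mass_scale, inv_mul_cancel₀ h.ne', Complex.ofReal_one],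
      (scale (mass θ)⁻¹ (inv_nonneg.2 h.le) θ).2.2⟩
  -- Only the zero functional has mass zero, and `homog` multiplies the value there by that mass, so
  -- the choice is immaterial.
  else Classical.arbitrary _

theorem normalize_val {θ : posTraces A} (h : 0 < mass θ) :
    (normalize θ).1 = (((mass θ)⁻¹ : ℝ) : ℂ) • θ.1 := by
  rw [normalize, dif_pos h, scale_val]

theorem normalize_ofState (τ : T A) : normalize (ofState τ) = τ := by
  refine Subtype.ext ?_
  rw [normalize_val (by rw [mass_ofState]; exact zero_lt_one), mass_ofState, inv_one,
    Complex.ofReal_one, one_smul]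
  rfl

/-- The extension of a function on the tracial states to a homogeneous function on the cone. -/
def homog (f : T A → ℝ) (θ : posTraces A) : ℝ := mass θ * f (normalize θ)

variable {f g : T A → ℝ}

theorem homog_zero : homog f 0 = 0 := by
  have : mass (0 : posTraces A) = 0 := Complex.zero_re
  rw [homog, this, zero_mul]

theorem homog_ofState (τ : T A) : homog f (ofState τ) = f τ := by
  rw [homog, mass_ofState, normalize_ofState, one_mul]

theorem homog_nonneg (hf : ∀ τ, 0 ≤ f τ) (θ : posTraces A) : 0 ≤ homog f θ :=
  mul_nonneg (mass_nonneg θ) (hf _)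

theorem homog_mono (hfg : ∀ τ, f τ ≤ g τ) (θ : posTraces A) : homog f θ ≤ homog g θ :=
  mul_le_mul_of_nonneg_left (hfg _) (mass_nonneg θ)

/-- The normalised sum is the convex combination of the normalised summands with weights
proportional to their masses; a summand of mass zero is zero. -/
theorem homog_add (hf : IsAffine f) (θ ψ : posTraces A) :
    homog f (θ + ψ) = homog f θ + homog f ψ := by
  rcases (mass_nonneg θ).eq_or_lt with hθ | hθ
  · rw [eq_zero_of_mass_eq_zero hθ.symm, zero_add, homog_zero, zero_add]
  rcases (mass_nonneg ψ).eq_or_lt with hψ | hψ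
  · rw [eq_zero_of_mass_eq_zero hψ.symm, add_zero, homog_zero, add_zero]
  have hs : 0 < mass θ + mass ψ := add_pos hθ hψ
  have hs' : 0 < mass (θ + ψ) := by rwa [mass_add]
  have e1 : 1 - mass θ / (mass θ + mass ψ) = mass ψ / (mass θ + mass ψ) := by
    field_simp
    ring
  have h := hf (normalize θ) (normalize ψ) (normalize (θ + ψ)) (mass θ / (mass θ + mass ψ))
    (by positivity) ((div_le_one hs).2 (by linarith)) (by
      rw [normalize_val hθ, normalize_val hψ, normalize_val hs', mass_add, e1]
      refine DFunLike.ext _ _ fun a => ?_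
      change (((mass θ + mass ψ)⁻¹ : ℝ) : ℂ) * (θ.1 a + ψ.1 a) =
        ((mass θ / (mass θ + mass ψ) : ℝ) : ℂ) * ((((mass θ)⁻¹ : ℝ) : ℂ) * θ.1 a) +
        ((mass ψ / (mass θ + mass ψ) : ℝ) : ℂ) * ((((mass ψ)⁻¹ : ℝ) : ℂ) * ψ.1 a)
      have h1 : (mass θ : ℂ) ≠ 0 := by exact_mod_cast hθ.ne'
      have h2 : (mass ψ : ℂ) ≠ 0 := by exact_mod_cast hψ.ne'
      have h3 : (mass θ + mass ψ : ℂ) ≠ 0 := by exact_mod_cast hs.ne'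
      push_cast
      field_simp)
  rw [homog, h, mass_add, e1, homog, homog]
  field_simp

theorem homog_scale {c : ℝ} (hc : 0 < c) (θ : posTraces A) :
    homog f (scale c hc.le θ) = c * homog f θ := by
  rcases (mass_nonneg θ).eq_or_lt with hθ | hθ
  · rw [homog, mass_scale, ← hθ, homog, ← hθ]
    ring
  have h : 0 < mass (scale c hc.le θ) := by
    rw [mass_scale]
    positivity
  have e : normalize (scale c hc.le θ) = normalize θ := by
    refine Subtype.ext ?_
    rw [normalize_val h, normalize_val hθ, mass_scale, scale_val, smul_smul,
      ← Complex.ofReal_mul]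
    congr 2
    field_simp
  rw [homog, homog, e, mass_scale, mul_assoc]

theorem continuousAt_normalize {θ : posTraces A} (h : 0 < mass θ) :
    ContinuousAt normalize θ := by
  rw [Topology.IsInducing.subtypeVal.continuousAt_iff]
  have hc : ContinuousAt (fun ψ : posTraces A => (((mass ψ)⁻¹ : ℝ) : ℂ) • ψ.1) θ :=
    (Complex.continuous_ofReal.continuousAt.comp
      (continuous_mass.continuousAt.inv₀ h.ne')).smul continuous_subtype_val.continuousAt
  refine hc.congr ?_
  filter_upwards [continuous_mass.continuousAt.eventually_const_lt h] with ψ hψ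
  exact (normalize_val hψ).symm

/-- Normalisation is continuous where the mass is positive. At mass zero the value is `0`, the least
possible one, so nothing is needed there. -/
theorem lowerSemicontinuous_homog (hf : LowerSemicontinuous f) (hf0 : ∀ τ, 0 ≤ f τ) :
    LowerSemicontinuous (homog f) := by
  intro θ y hy
  rcases (mass_nonneg θ).eq_or_lt with hθ | hθ
  · refine Filter.Eventually.of_forall fun ψ => ?_
    rw [homog, ← hθ, zero_mul] at hy
    exact hy.trans_le (homog_nonneg hf0 ψ)
  · have h1 : y / mass θ < f (normalize θ) := by
      rw [div_lt_iff₀ hθ, mul_comm]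
      exact hy
    obtain ⟨z, hz, hz'⟩ := exists_between h1
    have h2 : y < mass θ * z := by
      rwa [div_lt_iff₀ hθ, mul_comm] at hz
    have h3 : ContinuousAt (fun ψ : posTraces A => mass ψ * z) θ :=
      (continuous_mass.mul continuous_const).continuousAt
    filter_upwards [(continuousAt_normalize hθ).eventually (hf _ _ hz'),
      h3.eventually_const_lt h2] with ψ hψ hψ'
    exact hψ'.trans_le (mul_le_mul_of_nonneg_left (le_of_lt hψ) (mass_nonneg ψ))

end Homogenization

/-! ### Greatest affine minorants -/

section Meet

variable {A : Type u} [CStarAlgebra A] [PartialOrder A] [StarOrderedRing A] [Nonempty (T A)]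

variable {f g : T A → ℝ}

/-- The greatest affine minorant of two affine functions on the tracial states. -/
def meet (f g : T A → ℝ) (τ : T A) : ℝ := infConv (homog f) (homog g) (ofState τ)

theorem lowerSemicontinuous_homog_add (hf : LowerSemicontinuous f) (hg : LowerSemicontinuous g)
    (hf0 : ∀ τ, 0 ≤ f τ) (hg0 : ∀ τ, 0 ≤ g τ) :
    LowerSemicontinuous fun p : posTraces A × posTraces A => homog f p.1 + homog g p.2 :=
  ((lowerSemicontinuous_homog hf hf0).comp continuous_fst).add
    ((lowerSemicontinuous_homog hg hg0).comp continuous_snd)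

theorem isCompact_of_mass_add {s : Set (posTraces A × posTraces A)} (hs : IsClosed s)
    (h : ∀ p ∈ s, mass (p.1 + p.2) ≤ 1) : IsCompact s := by
  refine (isCompact_mass_le_one.prod isCompact_mass_le_one).of_isClosed_subset hs fun p hp => ?_
  have h1 := h p hp
  rw [mass_add] at h1
  have h2 := mass_nonneg p.1
  have h3 := mass_nonneg p.2
  exact ⟨show mass p.1 ≤ 1 by linarith, show mass p.2 ≤ 1 by linarith⟩

theorem continuous_add_posTraces :
    Continuous fun p : posTraces A × posTraces A => p.1 + p.2 :=
  Continuous.subtype_mk ((continuous_subtype_val.comp continuous_fst).add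
    (continuous_subtype_val.comp continuous_snd)) _

/-- The infimum that defines `meet f g` is attained. -/
theorem exists_meet_eq (hf : LowerSemicontinuous f) (hg : LowerSemicontinuous g)
    (hf0 : ∀ τ, 0 ≤ f τ) (hg0 : ∀ τ, 0 ≤ g τ) (τ : T A) :
    ∃ y z, y + z = ofState τ ∧ meet f g τ = homog f y + homog g z := by
  -- The parts of a tracial state have mass at most `1`, so its decompositions form a compact set,
  -- on which a lower semicontinuous function attains its minimum.
  have hcl : IsClosed {p : posTraces A × posTraces A | p.1 + p.2 = ofState τ} :=
    isClosed_eq continuous_add_posTraces continuous_const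
  have hcomp := isCompact_of_mass_add hcl fun p (hp : _ = _) => by rw [hp, mass_ofState]
  obtain ⟨p, hp, hmin⟩ := LowerSemicontinuousOn.exists_isMinOn
    (s := {p : posTraces A × posTraces A | p.1 + p.2 = ofState τ})
    ⟨(ofState τ, 0), add_zero (ofState τ)⟩ hcomp
    ((lowerSemicontinuous_homog_add hf hg hf0 hg0).lowerSemicontinuousOn _)
  refine ⟨p.1, p.2, hp, le_antisymm (infConv_le (homog_nonneg hf0) (homog_nonneg hg0) hp) ?_⟩
  exact le_infConv fun y z h => hmin (show (y, z) ∈ {p : posTraces A × posTraces A | _} from h)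

/-- As the infimum is attained, a sublevel set is the preimage in `T A` of the image, under
addition, of a compact set of pairs; hence it is closed. -/
theorem lowerSemicontinuous_meet (hf : LowerSemicontinuous f) (hg : LowerSemicontinuous g)
    (hf0 : ∀ τ, 0 ≤ f τ) (hg0 : ∀ τ, 0 ≤ g τ) : LowerSemicontinuous (meet f g) := by
  rw [lowerSemicontinuous_iff_isClosed_preimage]
  intro c
  let s : Set (posTraces A × posTraces A) :=
    {p | mass (p.1 + p.2) = 1} ∩ (fun p => homog f p.1 + homog g p.2) ⁻¹' Set.Iic c
  have hs : IsClosed s :=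
    (isClosed_eq (continuous_mass.comp continuous_add_posTraces) continuous_const).inter
      (lowerSemicontinuous_iff_isClosed_preimage.1
        (lowerSemicontinuous_homog_add hf hg hf0 hg0) c)
  have hcomp : IsCompact s := isCompact_of_mass_add hs fun p hp => hp.1.le
  have him := (hcomp.image
    (continuous_subtype_val.comp continuous_add_posTraces)).isClosed.preimage
    (continuous_subtype_val (p := fun τ => τ ∈ tracialStates A))
  convert him using 1
  ext τ
  constructor
  · intro h
    obtain ⟨y, z, hyz, he⟩ := exists_meet_eq hf hg hf0 hg0 τ
    refine ⟨(y, z), ⟨?_, ?_⟩, ?_⟩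
    · change mass (y + z) = 1
      rw [hyz, mass_ofState]
    · change homog f y + homog g z ≤ c
      rw [← he]
      exact h
    · change (y + z).1 = τ.1
      rw [hyz]
      rfl
  · rintro ⟨p, ⟨-, hp⟩, he⟩
    have h : p.1 + p.2 = ofState τ := Subtype.ext he
    exact (infConv_le (homog_nonneg hf0) (homog_nonneg hg0) h).trans hp

theorem infConv_homog_scale (hf0 : ∀ τ, 0 ≤ f τ) (hg0 : ∀ τ, 0 ≤ g τ) {c : ℝ} (hc : 0 ≤ c)
    (θ : posTraces A) : infConv (homog f) (homog g) (scale c hc θ) =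
      c * infConv (homog f) (homog g) θ := by
  have hle (c : ℝ) (hc : 0 < c) (θ : posTraces A) :
      infConv (homog f) (homog g) (scale c hc.le θ) ≤ c * infConv (homog f) (homog g) θ := by
    rw [← div_le_iff₀' hc]
    refine le_infConv fun y z h => ?_
    rw [div_le_iff₀' hc, mul_add, ← homog_scale hc, ← homog_scale hc]
    refine infConv_le (homog_nonneg hf0) (homog_nonneg hg0) ?_
    rw [← scale_add, h]
  rcases hc.eq_or_lt with rfl | hc'
  · have e : scale 0 hc θ = 0 := eq_zero_of_mass_eq_zero (by rw [mass_scale, zero_mul])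
    rw [e, zero_mul]
    refine le_antisymm ?_ (infConv_nonneg (homog_nonneg hf0) (homog_nonneg hg0) _)
    have h := infConv_le (homog_nonneg hf0) (homog_nonneg hg0) (add_zero (0 : posTraces A))
    rwa [homog_zero, homog_zero, add_zero] at h
  · refine le_antisymm (hle c hc' θ) ?_
    have h := hle c⁻¹ (inv_pos.2 hc') (scale c hc θ)
    have e : scale c⁻¹ (inv_pos.2 hc').le (scale c hc θ) = θ := by
      have := scale_inv_scale (inv_pos.2 hc') θ
      simpa only [inv_inv] using this
    rw [e] at h
    rwa [← div_eq_inv_mul, le_div_iff₀' hc'] at h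

/-- This is where the simplex property of the traces enters: refinement makes the infimal
convolution additive on the cone. -/
theorem isAffine_meet (hf : IsAffine f) (hg : IsAffine g) (hf0 : ∀ τ, 0 ≤ f τ)
    (hg0 : ∀ τ, 0 ≤ g τ) : IsAffine (meet f g) := by
  intro σ ρ υ t ht ht' h
  have e : ofState υ = scale t ht (ofState σ) + scale (1 - t) (sub_nonneg.2 ht') (ofState ρ) :=
    Subtype.ext h
  rw [meet, e, infConv_add hasRefinement_posTraces (homog_nonneg hf0) (homog_nonneg hg0)
    (homog_add hf) (homog_add hg), infConv_homog_scale hf0 hg0, infConv_homog_scale hf0 hg0]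
  rfl

theorem meet_le_left (hf0 : ∀ τ, 0 ≤ f τ) (hg0 : ∀ τ, 0 ≤ g τ) (τ : T A) :
    meet f g τ ≤ f τ := by
  have h := infConv_le (homog_nonneg hf0) (homog_nonneg hg0) (add_zero (ofState τ))
  rwa [homog_ofState, homog_zero, add_zero] at h

theorem meet_le_right (hf0 : ∀ τ, 0 ≤ f τ) (hg0 : ∀ τ, 0 ≤ g τ) (τ : T A) :
    meet f g τ ≤ g τ := by
  have h := infConv_le (homog_nonneg hf0) (homog_nonneg hg0) (zero_add (ofState τ))
  rwa [homog_ofState, homog_zero, zero_add] at h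

theorem le_meet {c : T A → ℝ} (hc : IsAffine c) (hcf : ∀ τ, c τ ≤ f τ) (hcg : ∀ τ, c τ ≤ g τ)
    (τ : T A) : c τ ≤ meet f g τ := by
  refine le_infConv fun y z h => ?_
  rw [← homog_ofState (f := c) τ, ← h, homog_add hc]
  exact add_le_add (homog_mono hcf y) (homog_mono hcg z)

/-- Strict positivity survives the infimum because it is attained at a decomposition with a nonzero
part. -/
theorem meet_pos (hf : LowerSemicontinuous f) (hg : LowerSemicontinuous g)
    (hf0 : ∀ τ, 0 < f τ) (hg0 : ∀ τ, 0 < g τ) (τ : T A) : 0 < meet f g τ := by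
  obtain ⟨y, z, hyz, he⟩ := exists_meet_eq hf hg (fun τ => (hf0 τ).le) (fun τ => (hg0 τ).le) τ
  rw [he]
  have hm : mass y + mass z = 1 := by rw [← mass_add, hyz, mass_ofState]
  have hy := mass_nonneg y
  have hy' := homog_nonneg (fun τ => (hf0 τ).le) y
  have hz' := homog_nonneg (fun τ => (hg0 τ).le) z
  rcases hy.eq_or_lt with h | h
  · have hz : 0 < mass z := by linarith
    have : 0 < homog g z := mul_pos hz (hg0 _)
    linarith
  · have : 0 < homog f y := mul_pos h (hf0 _)
    linarith

/-- The meet of two elements of `LAff A`. -/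
def LAff.meet (f g : LAff A) : LAff A where
  toFun := CuntzDim.meet f.toFun g.toFun
  affine := isAffine_meet f.affine g.affine (fun τ => (f.pos τ).le) fun τ => (g.pos τ).le
  lsc := lowerSemicontinuous_meet f.lsc g.lsc (fun τ => (f.pos τ).le) fun τ => (g.pos τ).le
  bounded := by
    obtain ⟨C, hC⟩ := f.bounded
    refine ⟨C, fun τ => ?_⟩
    rw [abs_of_pos (meet_pos f.lsc g.lsc f.pos g.pos τ)]
    exact (meet_le_left (fun τ => (f.pos τ).le) (fun τ => (g.pos τ).le) τ).trans
      ((le_abs_self _).trans (hC τ))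
  pos := meet_pos f.lsc g.lsc f.pos g.pos

end Meet

/-! ### The dimensions `d_τ` on the Cuntz semigroup -/

section RankOnW

variable {A : Type u} [CStarAlgebra A] [PartialOrder A] [StarOrderedRing A]

theorem W.exists_mk (x : W A) : ∃ a : PosMat A, W.mk a = x := Quotient.exists_rep x

/-- The dimension `d_τ` on the Cuntz semigroup. -/
def W.rk (x : W A) (τ : T A) : ℝ :=
  Quotient.lift (s := AntisymmRel.setoid (PosMat A) (· ≤ ·)) (fun a => rank τ a.mat)
    (fun a b h => le_antisymm (rank_le_of_cuntzLE τ a.nonneg b.nonneg h.1)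
      (rank_le_of_cuntzLE τ b.nonneg a.nonneg h.2)) x

theorem W.rk_mk (a : PosMat A) (τ : T A) : (W.mk a).rk τ = rank τ a.mat := rfl

theorem W.rk_nonneg (x : W A) (τ : T A) : 0 ≤ x.rk τ := by
  obtain ⟨a, rfl⟩ := x.exists_mk
  exact rank_nonneg τ a.nonneg

theorem W.rk_mono {x y : W A} (h : x ≤ y) (τ : T A) : x.rk τ ≤ y.rk τ := by
  obtain ⟨a, rfl⟩ := x.exists_mk
  obtain ⟨b, rfl⟩ := y.exists_mk
  exact rank_le_of_cuntzLE τ a.nonneg b.nonneg h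

theorem W.rk_add (x y : W A) (τ : T A) : (x + y).rk τ = x.rk τ + y.rk τ := by
  obtain ⟨a, rfl⟩ := x.exists_mk
  obtain ⟨b, rfl⟩ := y.exists_mk
  exact rank_dsum τ a.nonneg b.nonneg

theorem W.rk_unit (τ : T A) : (W.unit A).rk τ = 1 := by
  have h := rank_proj τ ⟨1, 1, IsStarProjection.one _⟩
  rw [mtr_one, Nat.cast_one] at h
  exact h

theorem W.exists_rk_le (x : W A) : ∃ N : ℕ, ∀ τ, x.rk τ ≤ N := by
  obtain ⟨a, rfl⟩ := x.exists_mk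
  exact ⟨a.size, fun τ => rank_le_size τ a.nonneg⟩

end RankOnW

/-! ### Refinement in the cone of differences of affine functions -/

section AffineCone

variable {A : Type u} [CStarAlgebra A] [PartialOrder A] [StarOrderedRing A]

theorem LAff.ext {f g : LAff A} (h : ∀ τ, f.toFun τ = g.toFun τ) : f = g := by
  cases f
  cases g
  congr
  exact funext h

theorem IsAffine.add {f g : T A → ℝ} (hf : IsAffine f) (hg : IsAffine g) :
    IsAffine fun τ => f τ + g τ := fun σ ρ υ t ht ht' h => by
  beta_reduce
  rw [hf σ ρ υ t ht ht' h, hg σ ρ υ t ht ht' h]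
  ring

theorem IsAffine.sub {f g : T A → ℝ} (hf : IsAffine f) (hg : IsAffine g) :
    IsAffine fun τ => f τ - g τ := fun σ ρ υ t ht ht' h => by
  beta_reduce
  rw [hf σ ρ υ t ht ht' h, hg σ ρ υ t ht ht' h]
  ring

/-- The sum of two elements of `LAff A`. -/
instance : Add (LAff A) where
  add f g :=
    { toFun := fun τ => f.toFun τ + g.toFun τ
      affine := f.affine.add g.affine
      lsc := f.lsc.add g.lsc
      bounded := by
        obtain ⟨C, hC⟩ := f.bounded
        obtain ⟨D, hD⟩ := g.bounded
        exact ⟨C + D, fun τ => (abs_add_le _ _).trans (add_le_add (hC τ) (hD τ))⟩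
      pos := fun τ => add_pos (f.pos τ) (g.pos τ) }

theorem LAff.add_toFun (f g : LAff A) (τ : T A) : (f + g).toFun τ = f.toFun τ + g.toFun τ := rfl

variable (A) in
/-- A positive constant function. -/
def LAff.const (c : ℝ) (hc : 0 < c) : LAff A where
  toFun := fun _ => c
  affine := fun _ _ _ t _ _ _ => by ring
  lsc := lowerSemicontinuous_const
  bounded := ⟨|c|, fun _ => le_rfl⟩
  pos := fun _ => hc

variable (A) in
/-- The cone of the nonnegative functions among the differences of elements of `LAff A`. -/
def affCone : AddSubmonoid (T A → ℝ) where
  carrier := {h | (∀ τ, 0 ≤ h τ) ∧ ∃ f g : LAff A, ∀ τ, h τ = f.toFun τ - g.toFun τ}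
  zero_mem' := ⟨fun _ => le_rfl, .const A 1 one_pos, .const A 1 one_pos, fun _ => (sub_self _).symm⟩
  add_mem' := by
    rintro h k ⟨hh, f, g, hfg⟩ ⟨hk, f', g', hfg'⟩
    refine ⟨fun τ => add_nonneg (hh τ) (hk τ), f + f', g + g', fun τ => ?_⟩
    rw [Pi.add_apply, hfg, hfg', LAff.add_toFun, LAff.add_toFun]
    ring

/-- The corner `z₁₁` is to be the greatest affine minorant of `x₁ = a - b` and `y₁ = c - d`. These
need not be lower semicontinuous, so the minorant is taken after adding `b + d`, inside `LAff A`.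
The row and column sums determine the other corners. -/
theorem hasRefinement_affCone [Nonempty (T A)] : HasRefinement (affCone A) := by
  rintro ⟨x₁, hx₁, a, b, hab⟩ ⟨x₂, hx₂, a', b', hab'⟩ ⟨y₁, hy₁, c, d, hcd⟩ ⟨y₂, hy₂, _⟩ h
  have hsum (τ : T A) : x₁ τ + x₂ τ = y₁ τ + y₂ τ := congrFun (congrArg Subtype.val h) τ
  set m := (a + d).meet (c + b) with hm
  have hpos (f : LAff A) (τ : T A) : 0 ≤ f.toFun τ := (f.pos τ).le
  have hml (τ : T A) : m.toFun τ ≤ a.toFun τ + d.toFun τ := meet_le_left (hpos _) (hpos _) τ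
  have hmr (τ : T A) : m.toFun τ ≤ c.toFun τ + b.toFun τ := meet_le_right (hpos _) (hpos _) τ
  have hm₁ (τ : T A) : b.toFun τ + d.toFun τ ≤ m.toFun τ := by
    refine le_meet (f := (a + d).toFun) (g := (c + b).toFun) (b + d).affine (fun σ => ?_)
      (fun σ => ?_) τ
    · have := hx₁ σ
      rw [hab] at this
      rw [LAff.add_toFun, LAff.add_toFun]
      linarith
    · have := hy₁ σ
      rw [hcd] at this
      rw [LAff.add_toFun, LAff.add_toFun]
      linarith
  -- This is nonnegativity of the corner `z₂₂ = x₂ - y₁ + z₁₁`. The left side is an affine minorant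
  -- of `c + b` since `x₂ ≥ 0`, and of `a + d` since `y₂ ≥ 0`.
  have hm₂ (τ : T A) : c.toFun τ + b.toFun τ - x₂ τ ≤ m.toFun τ := by
    have haff : IsAffine fun σ => (c + b).toFun σ - x₂ σ := by
      have e : x₂ = fun σ => a'.toFun σ - b'.toFun σ := funext hab'
      rw [e]
      exact (c + b).affine.sub (a'.affine.sub b'.affine)
    refine le_meet (f := (a + d).toFun) (g := (c + b).toFun) haff (fun σ => ?_)
      (fun σ => ?_) τ
    · have h1 := hsum σ
      have h2 := hy₂ σ
      rw [hab, hcd] at h1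
      rw [LAff.add_toFun, LAff.add_toFun]
      linarith
    · linarith [hx₂ σ]
  refine ⟨⟨fun τ => m.toFun τ - (b + d).toFun τ, fun τ => ?_, m, b + d, fun _ => rfl⟩,
    ⟨fun τ => (a + d).toFun τ - m.toFun τ, fun τ => ?_, a + d, m, fun _ => rfl⟩,
    ⟨fun τ => (c + b).toFun τ - m.toFun τ, fun τ => ?_, c + b, m, fun _ => rfl⟩,
    ⟨fun τ => (a' + m).toFun τ - (b' + (c + b)).toFun τ, fun τ => ?_, a' + m, b' + (c + b),
      fun _ => rfl⟩, Subtype.ext (funext fun τ => ?_), Subtype.ext (funext fun τ => ?_),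
      Subtype.ext (funext fun τ => ?_), Subtype.ext (funext fun τ => ?_)⟩
  · exact sub_nonneg.2 (hm₁ τ)
  · exact sub_nonneg.2 (hml τ)
  · exact sub_nonneg.2 (hmr τ)
  · have := hm₂ τ
    rw [hab'] at this
    simp only [LAff.add_toFun]
    linarith
  · change m.toFun τ - (b.toFun τ + d.toFun τ) + (a.toFun τ + d.toFun τ - m.toFun τ) = x₁ τ
    rw [hab]
    ring
  · change c.toFun τ + b.toFun τ - m.toFun τ +
      (a'.toFun τ + m.toFun τ - (b'.toFun τ + (c.toFun τ + b.toFun τ))) = x₂ τ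
    rw [hab']
    ring
  · change m.toFun τ - (b.toFun τ + d.toFun τ) + (c.toFun τ + b.toFun τ - m.toFun τ) = y₁ τ
    rw [hcd]
    ring
  · change a.toFun τ + d.toFun τ - m.toFun τ +
      (a'.toFun τ + m.toFun τ - (b'.toFun τ + (c.toFun τ + b.toFun τ))) = y₂ τ
    have := hsum τ
    rw [hab, hab', hcd] at this
    linarith

end AffineCone

/-! ### Sums in the Cuntz semigroup seen through the canonical map -/

section Canonical

variable {A : Type u} [CStarAlgebra A] [PartialOrder A] [StarOrderedRing A]

/-- Without tracial states the mixed order relations hold vacuously in both directions. Antisymmetry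
in `W A` would then identify points from the two disjoint parts of `WTilde A`. -/
theorem nonempty_T (φ : W A ≃o WTilde A) : Nonempty (T A) := by
  by_contra hne
  have hT (τ : T A) : False := hne ⟨τ⟩
  let f : WTilde A := .aff (.const A 1 one_pos)
  let p : WTilde A := .proj (V.mk ⟨0, 0, IsStarProjection.zero _⟩)
  have h1 : f ≤ p := fun τ => (hT τ).elim
  have h2 : p ≤ f := fun τ => (hT τ).elim
  have h3 : φ.symm f = φ.symm p :=
    le_antisymm (φ.symm.le_iff_le.2 h1) (φ.symm.le_iff_le.2 h2)
  have h4 : f = p := φ.symm.injective h3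
  simp [f, p] at h4

theorem CanonicalMap.exists_of_aff {x : W A} {f : LAff A} (h : CanonicalMap x (.aff f)) :
    ∃ a, x = W.mk a ∧ PurelyPositive a ∧ ∀ τ, rank τ a.mat = f.toFun τ := by
  cases h with
  | aff a ha f hf => exact ⟨a, rfl, ha, fun τ => tendsto_nhds_unique (dimValue_rank τ a) (hf τ)⟩

variable (φ : W A ≃o WTilde A)

/-- The element of the Cuntz semigroup with a given rank function. -/
def cls (f : LAff A) : W A := φ.symm (.aff f)

theorem cls_le_cls {f g : LAff A} (h : ∀ τ, f.toFun τ ≤ g.toFun τ) : cls φ f ≤ cls φ g :=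
  φ.symm.le_iff_le.2 h

variable {φ} (hφ : ∀ x, CanonicalMap x (φ x))

include hφ

theorem exists_of_cls (f : LAff A) :
    ∃ a, cls φ f = W.mk a ∧ PurelyPositive a ∧ ∀ τ, rank τ a.mat = f.toFun τ := by
  have h := hφ (cls φ f)
  rw [cls, φ.apply_symm_apply] at h
  exact h.exists_of_aff

theorem rk_cls (f : LAff A) (τ : T A) : (cls φ f).rk τ = f.toFun τ := by
  obtain ⟨a, ha, -, h⟩ := exists_of_cls hφ f
  rw [ha, W.rk_mk, h]

/-- Adding an arbitrary class to a purely positive one adds the rank functions. -/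
theorem exists_cls_add_eq (hsimple : IsSimpleCStar A) (f : LAff A) (x : W A) :
    ∃ g : LAff A, cls φ f + x = cls φ g ∧ ∀ τ, g.toFun τ = f.toFun τ + x.rk τ := by
  obtain ⟨τ₀⟩ := nonempty_T φ
  have hc := hφ (cls φ f + x)
  obtain ⟨a, ha, hpp, -⟩ := exists_of_cls hφ f
  obtain ⟨b, rfl⟩ := x.exists_mk
  generalize hy : cls φ f + W.mk b = y at hc
  generalize hz : φ y = z at hc
  cases hc with
  | proj p =>
    -- If the sum were the class of a projection, so would be its purely positive summand.
    rw [ha] at hy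
    obtain ⟨q, hq⟩ := exists_projection_of_add_eq hsimple τ₀ hy
    exact (hpp q hq).elim
  | aff c hc g hg =>
    have e : W.mk c = cls φ g := by rw [cls, ← hz, φ.symm_apply_apply]
    refine ⟨g, e, fun τ => ?_⟩
    rw [← rk_cls hφ g τ, ← e, ← hy, W.rk_add, rk_cls hφ]

theorem cls_add (hsimple : IsSimpleCStar A) (f g : LAff A) : cls φ f + cls φ g = cls φ (f + g) := by
  obtain ⟨h, he, hh⟩ := exists_cls_add_eq hφ hsimple f (cls φ g)
  rw [he]
  congr 1
  refine LAff.ext fun τ => ?_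
  rw [hh, rk_cls hφ, LAff.add_toFun]

/-- Adding the purely positive class of the constant `1` puts every class, also that of a
projection, in the range where `φ` records the rank function. -/
theorem exists_rk_eq_sub (hsimple : IsSimpleCStar A) (x : W A) :
    ∃ g : LAff A, ∀ τ, x.rk τ = g.toFun τ - (LAff.const A 1 one_pos).toFun τ := by
  obtain ⟨g, -, hg⟩ := exists_cls_add_eq hφ hsimple (LAff.const A 1 one_pos) x
  exact ⟨g, fun τ => by rw [hg]; ring⟩

theorem rk_mem_affCone (hsimple : IsSimpleCStar A) (x : W A) : x.rk ∈ affCone A := by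
  obtain ⟨g, hg⟩ := exists_rk_eq_sub hφ hsimple x
  exact ⟨x.rk_nonneg, g, _, hg⟩

/-- Pointwise domination of a rank function in `affCone A` is algebraic: the difference stays in the
cone. Positive additive functionals are therefore monotone along ranks. -/
theorem exists_rk_add_eq (hsimple : IsSimpleCStar A) {x : W A} {h : affCone A}
    (hle : ∀ τ, x.rk τ ≤ h.1 τ) :
    ∃ d : affCone A, ⟨x.rk, rk_mem_affCone hφ hsimple x⟩ + d = h := by
  obtain ⟨g, hg⟩ := exists_rk_eq_sub hφ hsimple x
  obtain ⟨f, f', hf⟩ := h.2.2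
  refine ⟨⟨fun τ => h.1 τ - x.rk τ, fun τ => sub_nonneg.2 (hle τ),
    f + LAff.const A 1 one_pos, f' + g, fun τ => ?_⟩, Subtype.ext (funext fun τ => ?_)⟩
  · beta_reduce
    rw [hf, hg, LAff.add_toFun, LAff.add_toFun]
    ring
  · change x.rk τ + (h.1 τ - x.rk τ) = h.1 τ
    ring

end Canonical

/-! ### Dimension functions as functionals on the affine cone, and their lattice order -/

section DimensionCone

variable {A : Type u} [CStarAlgebra A] [PartialOrder A] [StarOrderedRing A]

variable (A) in
/-- The cone of nonnegative additive order-preserving functions on the Cuntz semigroup. -/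
def dimCone : Set (W A → ℝ) :=
  {s | (∀ x, 0 ≤ s x) ∧ Monotone s ∧ ∀ x y, s (x + y) = s x + s y}

/-- The functional on the cone of affine functions induced by a function on the Cuntz
semigroup. -/
def induced (φ : W A ≃o WTilde A) (s : W A → ℝ) (h : affCone A) : ℝ :=
  s (cls φ h.2.2.choose) - s (cls φ h.2.2.choose_spec.choose)

variable {φ : W A ≃o WTilde A}

theorem induced_sub (s u : W A → ℝ) (h : affCone A) :
    induced φ (s - u) h = induced φ s h - induced φ u h := by
  simp only [induced, Pi.sub_apply]
  ring

variable (hφ : ∀ x, CanonicalMap x (φ x)) (hsimple : IsSimpleCStar A) {s : W A → ℝ}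

include hφ hsimple

/-- Independence of the chosen difference: `f' - g' = f - g` gives `f' + g = f + g'`, and `cls φ` is
additive. -/
theorem induced_eq (hs : s ∈ dimCone A) {h : affCone A} {f g : LAff A}
    (hfg : ∀ τ, h.1 τ = f.toFun τ - g.toFun τ) : induced φ s h = s (cls φ f) - s (cls φ g) := by
  have hspec := h.2.2.choose_spec.choose_spec
  rw [induced]
  set f' := h.2.2.choose
  set g' := h.2.2.choose_spec.choose
  have e : f' + g = f + g' := by
    refine LAff.ext fun τ => ?_
    have h1 := hfg τ
    have h2 : h.1 τ = f'.toFun τ - g'.toFun τ := hspec τ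
    rw [LAff.add_toFun, LAff.add_toFun]
    linarith
  have h1 := hs.2.2 (cls φ f') (cls φ g)
  have h2 := hs.2.2 (cls φ f) (cls φ g')
  rw [cls_add hφ hsimple, e] at h1
  rw [cls_add hφ hsimple] at h2
  linarith

theorem induced_nonneg (hs : s ∈ dimCone A) (h : affCone A) : 0 ≤ induced φ s h := by
  obtain ⟨f, g, hfg⟩ := h.2.2
  rw [induced_eq hφ hsimple hs hfg, sub_nonneg]
  refine hs.2.1 (cls_le_cls φ fun τ => ?_)
  have := h.2.1 τ
  rw [hfg] at this
  linarith

theorem induced_add (hs : s ∈ dimCone A) (h k : affCone A) :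
    induced φ s (h + k) = induced φ s h + induced φ s k := by
  obtain ⟨f, g, hfg⟩ := h.2.2
  obtain ⟨f', g', hfg'⟩ := k.2.2
  have hadd (τ : T A) : (h + k).1 τ = (f + f').toFun τ - (g + g').toFun τ := by
    change h.1 τ + k.1 τ = _
    rw [hfg, hfg', LAff.add_toFun, LAff.add_toFun]
    ring
  rw [induced_eq hφ hsimple hs hfg, induced_eq hφ hsimple hs hfg', induced_eq hφ hsimple hs hadd,
    ← cls_add hφ hsimple, ← cls_add hφ hsimple, hs.2.2, hs.2.2]
  ring

/-- The class of `1` plus `x` is the class of `1 + x.rk`, and the value at the class of `1` cancels.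
So `s` is recovered from its induced functional and depends on ranks only. -/
theorem induced_rk (hs : s ∈ dimCone A) (x : W A) :
    induced φ s ⟨x.rk, rk_mem_affCone hφ hsimple x⟩ = s x := by
  obtain ⟨g, he, hg⟩ := exists_cls_add_eq hφ hsimple (LAff.const A 1 one_pos) x
  rw [induced_eq hφ hsimple hs (f := g) (g := LAff.const A 1 one_pos)
    (fun τ => by rw [hg]; ring), ← he, hs.2.2]
  ring

theorem comp_rk_mem_dimCone {θ : affCone A → ℝ} (hθ : ∀ h, 0 ≤ θ h)
    (hadd : ∀ h k, θ (h + k) = θ h + θ k) :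
    (fun x : W A => θ ⟨x.rk, rk_mem_affCone hφ hsimple x⟩) ∈ dimCone A := by
  refine ⟨fun x => hθ _, fun x y hxy => ?_, fun x y => ?_⟩
  · obtain ⟨d, hd⟩ := exists_rk_add_eq hφ hsimple (x := x)
      (h := ⟨y.rk, rk_mem_affCone hφ hsimple y⟩) (W.rk_mono hxy)
    change θ ⟨x.rk, _⟩ ≤ θ ⟨y.rk, _⟩
    rw [← hd, hadd]
    exact le_add_of_nonneg_right (hθ d)
  · rw [← hadd]
    exact congrArg θ (Subtype.ext (funext (W.rk_add x y)))

/-- The hypothesis compares ranks only. The induced functional turns it into an inequality of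
values, since `N` minus the rank lies in `affCone A`. -/
theorem le_mul_unit (hs : s ∈ dimCone A) {x : W A} {N : ℕ} (hN : ∀ τ, x.rk τ ≤ N) :
    s x ≤ N * s (W.unit A) := by
  let e : affCone A := ⟨(W.unit A).rk, rk_mem_affCone hφ hsimple _⟩
  have hn (n : ℕ) : induced φ s (n • e) = n * s (W.unit A) := by
    induction n with
    | zero =>
      have h := induced_add hφ hsimple hs 0 0
      rw [add_zero] at h
      rw [zero_smul, Nat.cast_zero, zero_mul]
      linarith
    | succ n ih =>
      rw [succ_nsmul, induced_add hφ hsimple hs, ih, induced_rk hφ hsimple hs]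
      push_cast
      ring
  have hval (n : ℕ) (τ : T A) : (n • e).1 τ = n := by
    have : (n • e).1 τ = n • (W.unit A).rk τ := rfl
    rw [this, W.rk_unit, nsmul_eq_mul, mul_one]
  obtain ⟨d, hd⟩ := exists_rk_add_eq hφ hsimple (x := x) (h := N • e) fun τ => by
    rw [hval]
    exact hN τ
  rw [← hn, ← hd, induced_add hφ hsimple hs, induced_rk hφ hsimple hs]
  exact le_add_of_nonneg_right (induced_nonneg hφ hsimple hs d)

/-- Two elements of the cone of dimension functions have a greatest lower and a least upper
bound. -/
theorem isLatticeCone_dimCone : IsLatticeCone (dimCone A) := by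
  have := nonempty_T φ
  intro s hs s' hs'
  set a := induced φ s with ha
  set b := induced φ s' with hb
  have ha0 : ∀ h, 0 ≤ a h := induced_nonneg hφ hsimple hs
  have hb0 : ∀ h, 0 ≤ b h := induced_nonneg hφ hsimple hs'
  have ha' : ∀ h k, a (h + k) = a h + a k := induced_add hφ hsimple hs
  have hb' : ∀ h k, b (h + k) = b h + b k := induced_add hφ hsimple hs'
  have hc' := infConv_add hasRefinement_affCone ha0 hb0 ha' hb'
  have ha00 : a 0 = 0 := by
    have h := ha' 0 0
    rw [add_zero] at h
    linarith
  have hb00 : b 0 = 0 := by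
    have h := hb' 0 0
    rw [add_zero] at h
    linarith
  have hca (h : affCone A) : infConv a b h ≤ a h := by
    have := infConv_le ha0 hb0 (add_zero h)
    linarith
  have hcb (h : affCone A) : infConv a b h ≤ b h := by
    have := infConv_le ha0 hb0 (zero_add h)
    linarith
  let r (x : W A) : affCone A := ⟨x.rk, rk_mem_affCone hφ hsimple x⟩
  have hsr (u : W A → ℝ) (hu : u ∈ dimCone A) (x : W A) : induced φ u (r x) = u x :=
    induced_rk hφ hsimple hu x
  -- The Riesz-Kantorovich infimum, formed on `affCone A`, where refinement holds, and then
  -- restricted to ranks.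
  let i : W A → ℝ := fun x => infConv a b (r x)
  have hi : i ∈ dimCone A := comp_rk_mem_dimCone hφ hsimple (infConv_nonneg ha0 hb0) hc'
  have hmem (u : W A → ℝ) (θ : affCone A → ℝ) (hθ : ∀ h, 0 ≤ θ h)
      (hadd : ∀ h k, θ (h + k) = θ h + θ k) (hu : ∀ x, u x = θ (r x)) : u ∈ dimCone A := by
    have e : u = fun x => θ (r x) := funext hu
    rw [e]
    exact comp_rk_mem_dimCone hφ hsimple hθ hadd
  have hsi : s - i ∈ dimCone A :=
    hmem _ (fun h => a h - infConv a b h) (fun h => sub_nonneg.2 (hca h))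
      (fun h k => by rw [ha', hc']; ring) fun x => by
        rw [Pi.sub_apply, ← hsr s hs]
  have hs'i : s' - i ∈ dimCone A :=
    hmem _ (fun h => b h - infConv a b h) (fun h => sub_nonneg.2 (hcb h))
      (fun h k => by rw [hb', hc']; ring) fun x => by
        rw [Pi.sub_apply, ← hsr s' hs']
  have hle (u v : W A → ℝ) (huv : v - u ∈ dimCone A) (h : affCone A) :
      induced φ u h ≤ induced φ v h := by
    have := induced_nonneg hφ hsimple huv h
    rw [induced_sub] at this
    linarith
  -- As in a vector lattice, the supremum is `s + s' - i`.
  refine ⟨⟨s + (s' - i), ?_, ?_, ?_, fun u hu hus hus' => ?_⟩,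
    ⟨i, hi, hsi, hs'i, fun u hu hsu hs'u => ?_⟩⟩
  · exact hmem _ (fun h => a h + (b h - infConv a b h))
      (fun h => add_nonneg (ha0 h) (sub_nonneg.2 (hcb h)))
      (fun h k => by rw [ha', hb', hc']; ring) fun x => by
        rw [Pi.add_apply, Pi.sub_apply, ← hsr s hs, ← hsr s' hs']
  · rwa [add_sub_cancel_left]
  · have e : s + (s' - i) - s' = s - i := by abel
    rwa [e]
  · have hu' := induced_add hφ hsimple hu
    refine hmem _ (fun h => induced φ u h - (a h + (b h - infConv a b h))) (fun h => ?_)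
      (fun h k => by rw [ha', hb', hc', hu']; ring) fun x => by
        rw [Pi.sub_apply, Pi.add_apply, Pi.sub_apply, ← hsr s hs, ← hsr s' hs', ← hsr u hu]
    -- For `h = y + z`, the claim `a h + b h - u h ≤ a y + b z` reduces to `a z ≤ u z` and `b y ≤ u
    -- y`.
    have h1 : a h + b h - induced φ u h ≤ infConv a b h := by
      refine le_infConv fun y z hyz => ?_
      rw [← hyz, ha', hb', hu']
      have h2 := hle s u hus z
      have h3 := hle s' u hus' y
      linarith
    linarith
  · have hu' := induced_add hφ hsimple hu
    refine hmem _ (fun h => infConv a b h - induced φ u h) (fun h => ?_)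
      (fun h k => by rw [hc', hu']; ring) fun x => by
        rw [Pi.sub_apply, ← hsr u hu]
    refine sub_nonneg.2 (le_infConv fun y z hyz => ?_)
    rw [← hyz, hu']
    exact add_le_add (hle u s hsu y) (hle u s' hs'u z)

omit hφ hsimple in
theorem mem_dimCone_of_mem_DF (hs : s ∈ DF A) : s ∈ dimCone A := ⟨hs.1, hs.2.1, hs.2.2.1⟩

omit hφ hsimple in
theorem rk_mem_DF (τ : T A) : (fun x : W A => x.rk τ) ∈ DF A :=
  ⟨fun x => x.rk_nonneg τ, fun _ _ h => W.rk_mono h τ, fun x y => W.rk_add x y τ, W.rk_unit τ⟩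

/-- The second coordinate is the value at the unit. If that value is zero then `s = 0` by
`le_mul_unit`, so the point is the apex; otherwise dividing by it gives a dimension function. -/
theorem mem_coneOver_DF_iff {z : (W A → ℝ) × ℝ} :
    z ∈ coneOver (DF A) ↔ z.1 ∈ dimCone A ∧ z.2 = z.1 (W.unit A) := by
  constructor
  · rintro ⟨t, ht, s, hs, rfl⟩
    refine ⟨⟨fun x => mul_nonneg ht (hs.1 x), fun x y h => mul_le_mul_of_nonneg_left (hs.2.1 h) ht,
      fun x y => ?_⟩, ?_⟩
    · change t * s (x + y) = t * s x + t * s y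
      rw [hs.2.2.1, mul_add]
    · change t = t * s (W.unit A)
      rw [hs.2.2.2, mul_one]
  · obtain ⟨s, t⟩ := z
    rintro ⟨hs : s ∈ dimCone A, rfl : t = s (W.unit A)⟩
    rcases (hs.1 (W.unit A)).eq_or_lt with h | h
    · obtain ⟨τ⟩ := nonempty_T φ
      refine ⟨0, le_rfl, _, rk_mem_DF τ, ?_⟩
      rw [← h, zero_smul]
      refine Prod.ext (funext fun x => le_antisymm ?_ (hs.1 x)) rfl
      obtain ⟨N, hN⟩ := x.exists_rk_le
      have := le_mul_unit hφ hsimple hs hN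
      rwa [← h, mul_zero] at this
    · refine ⟨s (W.unit A), h.le, (s (W.unit A))⁻¹ • s, ⟨fun x => ?_, fun x y hxy => ?_,
        fun x y => ?_, ?_⟩, ?_⟩
      · exact mul_nonneg (inv_nonneg.2 h.le) (hs.1 x)
      · exact mul_le_mul_of_nonneg_left (hs.2.1 hxy) (inv_nonneg.2 h.le)
      · change (s (W.unit A))⁻¹ * s (x + y) = (s (W.unit A))⁻¹ * s x + (s (W.unit A))⁻¹ * s y
        rw [hs.2.2, mul_add]
      · exact inv_mul_cancel₀ h.ne'
      · rw [smul_smul, mul_inv_cancel₀ h.ne', one_smul]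

theorem isLatticeCone_coneOver_DF : IsLatticeCone (coneOver (DF A)) := by
  intro x hx y hy
  have key {z : (W A → ℝ) × ℝ} := mem_coneOver_DF_iff hφ hsimple (z := z)
  have hsub (u v : (W A → ℝ) × ℝ) (hu : u.2 = u.1 (W.unit A)) (hv : v.2 = v.1 (W.unit A)) :
      u - v ∈ coneOver (DF A) ↔ u.1 - v.1 ∈ dimCone A := by
    rw [key]
    refine and_iff_left ?_
    rw [Prod.snd_sub, Prod.fst_sub, Pi.sub_apply, hu, hv]
  rw [key] at hx hy
  obtain ⟨⟨s, hs, hsx, hsy, hsl⟩, ⟨i, hi, hxi, hyi, hil⟩⟩ :=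
    isLatticeCone_dimCone hφ hsimple x.1 hx.1 y.1 hy.1
  refine ⟨⟨(s, s (W.unit A)), key.2 ⟨hs, rfl⟩, (hsub _ _ rfl hx.2).2 hsx,
    (hsub _ _ rfl hy.2).2 hsy, fun u hu hux huy => ?_⟩,
    ⟨(i, i (W.unit A)), key.2 ⟨hi, rfl⟩, (hsub _ _ hx.2 rfl).2 hxi,
    (hsub _ _ hy.2 rfl).2 hyi, fun u hu hux huy => ?_⟩⟩
  · rw [key] at hu
    exact (hsub _ _ hu.2 rfl).2 (hsl _ hu.1 ((hsub _ _ hu.2 hx.2).1 hux)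
      ((hsub _ _ hu.2 hy.2).1 huy))
  · rw [key] at hu
    exact (hsub _ _ rfl hu.2).2 (hil _ hu.1 ((hsub _ _ hx.2 hu.2).1 hux)
      ((hsub _ _ hy.2 hu.2).1 huy))

/-- The ranks of a class are bounded uniformly in `τ`, and by `le_mul_unit` the same bound holds for
every dimension function. So `DF A` is a closed subset of a product of compact intervals. -/
theorem isCompact_DF : IsCompact (DF A) := by
  choose N hN using fun x : W A => x.exists_rk_le
  refine (isCompact_univ_pi fun x => isCompact_Icc (a := (0 : ℝ)) (b := N x)).of_isClosed_subset
    ?_ fun s hs x _ => ⟨hs.1 x, ?_⟩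
  · have e : DF A = (⋂ x, {s | 0 ≤ s x}) ∩ ((⋂ (x) (y) (_ : x ≤ y), {s | s x ≤ s y}) ∩
        ((⋂ (x) (y), {s | s (x + y) = s x + s y}) ∩ {s | s (W.unit A) = 1})) := by
      ext s
      simp [DF, Monotone]
    rw [e]
    refine IsClosed.inter (isClosed_iInter fun x => ?_) (IsClosed.inter (isClosed_iInter fun x =>
      isClosed_iInter fun y => isClosed_iInter fun _ => ?_) (IsClosed.inter (isClosed_iInter
        fun x => isClosed_iInter fun y => ?_) ?_))
    · exact isClosed_le continuous_const (continuous_apply _)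
    · exact isClosed_le (continuous_apply _) (continuous_apply _)
    · exact isClosed_eq (continuous_apply _) ((continuous_apply x).add (continuous_apply y))
    · exact isClosed_eq (continuous_apply _) continuous_const
  · have h := le_mul_unit hφ hsimple (mem_dimCone_of_mem_DF hs) (hN x)
    rwa [hs.2.2.2, mul_one] at h

omit hφ hsimple in
theorem convex_DF : Convex ℝ (DF A) := by
  intro s hs s' hs' a b ha hb hab
  refine ⟨fun x => ?_, fun x y h => ?_, fun x y => ?_, ?_⟩
  · exact add_nonneg (mul_nonneg ha (hs.1 x)) (mul_nonneg hb (hs'.1 x))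
  · exact add_le_add (mul_le_mul_of_nonneg_left (hs.2.1 h) ha)
      (mul_le_mul_of_nonneg_left (hs'.2.1 h) hb)
  · change a * s (x + y) + b * s' (x + y) = a * s x + b * s' x + (a * s y + b * s' y)
    rw [hs.2.2.1, hs'.2.2.1]
    ring
  · change a * s (W.unit A) + b * s' (W.unit A) = 1
    rw [hs.2.2.2, hs'.2.2.2, mul_one, mul_one, hab]

end DimensionCone

end CuntzDim

end

theorem mainTheorem3 {A : Type*} [CStarAlgebra A] [PartialOrder A] [StarOrderedRing A]
    [TopologicalSpace.SeparableSpace A] (hsimple : CuntzDim.IsSimpleCStar A)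
    (hexact : CuntzDim.IsExact A) (hfin : CuntzDim.IsStablyFinite A)
    (φ : CuntzDim.W A ≃o CuntzDim.WTilde A) (hφ : ∀ x, CuntzDim.CanonicalMap x (φ x)) :
    CuntzDim.IsChoquetSimplex (CuntzDim.DF A) := by
  obtain ⟨τ⟩ := CuntzDim.nonempty_T φ
  exact ⟨⟨_, CuntzDim.rk_mem_DF τ⟩, CuntzDim.isCompact_DF hφ hsimple, CuntzDim.convex_DF,
    CuntzDim.isLatticeCone_coneOver_DF hφ hsimple⟩
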